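/- Let $K\ge 1$, $P\ge 0$, $Q>0$. Consider the $K$-receiver Gaussian multicast channel with additive interference: in $n$ channel uses receiver $k\in\{1,\dots,K\}$ observes $Y_k^n=X^n+S_k^n+Z_k^n$, where the interferences $S_1^n,\dots,S_K^n$ and the noises $Z_1^n,\dots,Z_K^n$ are mutually independent, each $S_k^n$ is i.i.d. $\mathcal N(0,Q)$ and each $Z_k^n$ is i.i.d. $\mathcal N(0,1)$. A code with blocklength $n$ and rate $R\ge 0$ has message set $\mathcal W_n$ of size $\lceil 2^{nR}\rceil$, a (measurable) encoder $X^n=f_n(W,S_1^n,\dots,S_K^n)$ that knows all interferences noncausally and satisfies $\frac1n E\big[\sum_{i=1}^n X_i^2\big]\le P$ (expectation over the uniform message $W$ and the interferences), and (measurable) decoders $g_{k,n}(Y_k^n)\in\mathcal W_n$. The common rate $R$ is achievable if there is a sequence of such codes with $\Pr\{\exists k:\ g_{k,n}(Y_k^n)\ne W\}\to 0$; the capacity $C_K(P,Q)$ is the supremum of achievable rates. A code is a time-sharing code if each of the $n$ time slots is allotted to one receiver, in such a way that the inputs in the slots of receiver $k$ depend only on $W$ and on $S_k$ in those slots, and decoder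 $k$ uses only its outputs in those slots; $C_K^{\mathrm{TS}}(P,Q)$ is the supremum of the rates achievable with sequences of time-sharing codes. With logarithms to base $2$ and $[x]^+=\max(x,0)$: (a) for all $Q>0$, every achievable common rate $R$ satisfies $$R\le \frac12\log\big(P+Q+1+2\sqrt{PQ}\big)-\frac{K-1}{2K}\log Q-\frac1{2K}\log K-\Big[\frac1{2K}\log\Big(\frac{Q}{K(P+1)}\Big)\Big]^+ ;$$ (b) consequently time-sharing is optimal in the limit of large interference, for every number of receivers: for every fixed $K\ge1$ and $P\ge0$, $$\lim_{Q\to\infty}C_K(P,Q)=\lim_{Q\to\infty}C_K^{\mathrm{TS}}(P,Q)=\frac1{2K}\log(1+P).$$ -/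

import Mathlib

open MeasureTheory ProbabilityTheory Filter Topology

noncomputable section

namespace GaussianMulticast

/-- A code with blocklength `n` and `M` messages for the `K`-receiver multicast channel with
additive interference.  The encoder knows the message `w` and all interference sequences
`s k = (s k 0, …, s k (n-1))` noncausally; decoder `k` sees only the output sequence of
receiver `k`. -/
structure Code (K n M : ℕ) where
  enc : Fin M → (Fin K → Fin n → ℝ) → (Fin n → ℝ)
  dec : Fin K → (Fin n → ℝ) → Fin M
  measurable_enc : ∀ w, Measurable (enc w)
  measurable_dec : ∀ k, Measurable (dec k)

/-- The law of `K` mutually independent sequences of `n` i.i.d. `N(0, v)` variables. -/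
def gaussianSeqs (K n : ℕ) (v : ℝ) : Measure (Fin K → Fin n → ℝ) :=
  Measure.pi fun _ => Measure.pi fun _ => gaussianReal 0 v.toNNReal

/-- The sequence observed by receiver `k`, namely `Y_k = X + S_k + Z_k`, when message `w` is sent,
the interferences are `s` and the noises are `z`. -/
def Code.output {K n M : ℕ} (c : Code K n M) (w : Fin M) (s z : Fin K → Fin n → ℝ)
    (k : Fin K) : Fin n → ℝ :=
  fun i => c.enc w s i + s k i + z k i

/-- The average power constraint `(1/n) E[∑ᵢ Xᵢ²] ≤ P`, the expectation being over a uniform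
message and over the interferences of power `Q`. -/
def Code.PowerConstraint {K n M : ℕ} (c : Code K n M) (P Q : ℝ) : Prop :=
  (M : ENNReal)⁻¹ * ∑ w, ∫⁻ s, ENNReal.ofReal (∑ i, c.enc w s i ^ 2) ∂(gaussianSeqs K n Q)
    ≤ ENNReal.ofReal (n * P)

/-- The probability that at least one receiver errs, for a uniform message, interferences of
power `Q`, and independent noises of unit power that are independent of the interferences. -/
def Code.errorProb {K n M : ℕ} (c : Code K n M) (Q : ℝ) : ℝ :=
  (M : ℝ)⁻¹ * ∑ w, ((gaussianSeqs K n Q).prod (gaussianSeqs K n 1)).real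
    {p | ∃ k, c.dec k (c.output w p.1 p.2 k) ≠ w}

/-- The number of messages of a `(2^{nR}, n)` code. -/
def numMessages (n : ℕ) (R : ℝ) : ℕ := ⌈(2 : ℝ) ^ (n * R)⌉₊

/-- The rate `R` is achievable under power constraint `P` and interference power `Q`. -/
def IsAchievable (K : ℕ) (P Q R : ℝ) : Prop :=
  0 ≤ R ∧ ∃ c : ∀ n : ℕ, Code K n (numMessages n R),
    (∀ n, (c n).PowerConstraint P Q) ∧ Tendsto (fun n => (c n).errorProb Q) atTop (𝓝 0)

/-- The common-message capacity. -/
def capacity (K : ℕ) (P Q : ℝ) : ℝ := sSup {R | IsAchievable K P Q R}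

/-- A code time-shares between the receivers if every time slot `i` is allotted to a single
receiver `user i`, such that the input in the slots of receiver `k` depends only on the message and
on the interference of receiver `k` in those slots, and decoder `k` uses only its outputs in those
slots. -/
def Code.IsTimeSharing {K n M : ℕ} (c : Code K n M) : Prop :=
  ∃ user : Fin n → Fin K,
    (∀ w s s' i, (∀ j, user j = user i → s (user i) j = s' (user i) j) →
      c.enc w s i = c.enc w s' i) ∧
    (∀ k y y', (∀ j, user j = k → y j = y' j) → c.dec k y = c.dec k y')

/-- The rate `R` is achievable with time-sharing codes. -/
def IsTimeSharingAchievable (K : ℕ) (P Q R : ℝ) : Prop :=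
  0 ≤ R ∧ ∃ c : ∀ n : ℕ, Code K n (numMessages n R),
    (∀ n, (c n).IsTimeSharing) ∧
    (∀ n, (c n).PowerConstraint P Q) ∧ Tendsto (fun n => (c n).errorProb Q) atTop (𝓝 0)

/-- The largest common-message rate that time-sharing can achieve. -/
def timeSharingCapacity (K : ℕ) (P Q : ℝ) : ℝ := sSup {R | IsTimeSharingAchievable K P Q R}

end GaussianMulticast

end

open scoped ENNReal NNReal

namespace GaussianMulticast

/-! ### Densities of product measures -/

/-! Converse. An error event of receiver `k` involves only the noise of receiver `k`, so all
receivers may be given one common noise `z`. The outputs are then `Y_k = A + S_k`, with a single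
noisy input `A = X + z`. For a fixed message the map `(s, z) ↦ (y, a)` preserves Lebesgue measure,
whatever the encoder, so the entropy of `(Y, A)` is that of `(S, z)`, which is known. It is at most
the sum of the entropies of the `Y_k` given the message plus the entropy of `A` given `Y`. By Fano,
knowing the message lowers each output entropy by about `nR`. Gaussian maximum-entropy bounds then
give `K R ≤ K/2 log (σ/Q) + 1/2 log v`, where `σ` bounds the output power and `v` is the mean
squared error of any estimate of `A` from `Y`. The estimate `0` has `v = P + 1`. The average of the
outputs misses `A` by the average of the interferences, so it has `v = Q/K`. The better of the two
produces the positive part in the bound.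

The formal argument uses no entropies. It compares the true law with a Gaussian test law of `(y,
a)`, tilted by weights that reward correct decoding, and applies Jensen to the density ratio:
`lintegral_testRatio`, `sum_integral_log_le` and `Code.log_card_le_of_deviation` carry this, and
`IsAchievable.le_bound` concludes.

Achievability. In its own slots each receiver has a point-to-point channel with interference known
at the encoder. Dirty-paper coding reaches `1/2 log (1 + P)` there for every `Q` (`exists_codebook`,
`exists_dirtyPaperCode`), and round-robin slots divide this by `K`. As `Q → ∞` we have `σ/Q → 1`, so
the converse with `v = P + 1` squeezes both capacities to that value. -/

theorem lintegral_pi_prod_eq_prod {n : ℕ} {E : Type*} [MeasurableSpace E] (μ : Measure E)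
    [SigmaFinite μ] {f : Fin n → E → ℝ≥0∞} (hf : ∀ i, Measurable (f i)) :
    ∫⁻ x, ∏ i, f i (x i) ∂(Measure.pi fun _ : Fin n => μ) = ∏ i, ∫⁻ x, f i x ∂μ := by
  induction n with
  | zero => simp
  | succ n ih =>
    rw [← ((measurePreserving_piFinSuccAbove (fun _ : Fin (n + 1) => μ) 0).symm).lintegral_comp_emb
      (MeasurableEquiv.measurableEmbedding _)]
    have h : ∀ z : E × (Fin n → E),
        ∏ i, f i ((MeasurableEquiv.piFinSuccAbove (fun _ : Fin (n + 1) => E) 0).symm z i) =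
          f 0 z.1 * ∏ i : Fin n, f i.succ (z.2 i) := fun z => Fin.prod_univ_succ _
    rw [lintegral_congr h, Fin.prod_univ_succ]
    rw [lintegral_prod_mul (g := fun y : Fin n → E => ∏ i : Fin n, f i.succ (y i))
      (hf 0).aemeasurable (Measurable.aemeasurable (by fun_prop)), ih fun i => hf i.succ]

theorem pi_withDensity_eq {n : ℕ} {E : Type*} [MeasurableSpace E] (μ : Measure E)
    [SigmaFinite μ] {f : E → ℝ≥0∞} (hf : Measurable f) [SigmaFinite (μ.withDensity f)] :
    (Measure.pi fun _ : Fin n => μ.withDensity f) =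
      (Measure.pi fun _ : Fin n => μ).withDensity fun x => ∏ i, f (x i) := by
  refine (Measure.pi_eq fun s hs => ?_)
  rw [withDensity_apply _ (MeasurableSet.univ_pi hs),
    ← lintegral_indicator (MeasurableSet.univ_pi hs)]
  have h : ∀ x : Fin n → E, (Set.univ.pi s).indicator (fun x => ∏ i, f (x i)) x =
      ∏ i, (s i).indicator f (x i) := by
    intro x
    by_cases hx : x ∈ Set.univ.pi s
    · rw [Set.indicator_of_mem hx]
      exact Finset.prod_congr rfl fun i _ => (Set.indicator_of_mem (hx i trivial) _).symm
    · rw [Set.indicator_of_notMem hx]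
      simp only [Set.mem_univ_pi, not_forall] at hx
      obtain ⟨i, hi⟩ := hx
      exact (Finset.prod_eq_zero (Finset.mem_univ i) (Set.indicator_of_notMem hi _)).symm
  simp_rw [h]
  rw [lintegral_pi_prod_eq_prod μ fun i => hf.indicator (hs i)]
  exact Finset.prod_congr rfl fun i _ => by
    rw [lintegral_indicator (hs i), withDensity_apply _ (hs i)]

/-! ### Sequences of i.i.d. centered Gaussian variables -/

/-- The law of `n` i.i.d. `N(0, v)` variables. -/
noncomputable abbrev gaussianSeq (n : ℕ) (v : ℝ) : Measure (Fin n → ℝ) :=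
  Measure.pi fun _ => gaussianReal 0 v.toNNReal

instance (K n : ℕ) (v : ℝ) : IsProbabilityMeasure (gaussianSeqs K n v) := by
  unfold gaussianSeqs; infer_instance

/-- The density of `n` i.i.d. `N(0, v)` variables. -/
noncomputable def seqPDF (n : ℕ) (v : ℝ) (x : Fin n → ℝ) : ℝ :=
  ∏ i, gaussianPDFReal 0 v.toNNReal (x i)

@[fun_prop]
theorem measurable_seqPDF (n : ℕ) (v : ℝ) : Measurable (seqPDF n v) := by
  unfold seqPDF
  exact Finset.measurable_prod _ fun i _ =>
    (measurable_gaussianPDFReal _ _).comp (measurable_pi_apply i)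

theorem seqPDF_pos {n : ℕ} {v : ℝ} (hv : 0 < v) (x : Fin n → ℝ) : 0 < seqPDF n v x :=
  Finset.prod_pos fun i _ => gaussianPDFReal_pos _ _ _ (by simpa using hv)

theorem log_seqPDF {n : ℕ} {v : ℝ} (hv : 0 < v) (x : Fin n → ℝ) :
    Real.log (seqPDF n v x) =
      -(n / 2 * Real.log (2 * Real.pi * v)) - (∑ i, x i ^ 2) / (2 * v) := by
  have h : ∀ y : ℝ, Real.log (gaussianPDFReal 0 v.toNNReal y) =
      -(1 / 2 * Real.log (2 * Real.pi * v)) - y ^ 2 / (2 * v) := by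
    intro y
    have h0 : 0 < 2 * Real.pi * v := by positivity
    rw [gaussianPDFReal_def]
    simp only [Real.coe_toNNReal v hv.le, sub_zero]
    rw [Real.log_mul (by positivity) (by positivity), Real.log_inv, Real.log_exp,
      Real.log_sqrt h0.le]
    ring
  unfold seqPDF
  rw [Real.log_prod fun i _ => (gaussianPDFReal_pos _ _ _ (by simpa using hv)).ne']
  simp_rw [h, Finset.sum_sub_distrib, Finset.sum_div]
  simp
  ring

theorem gaussianSeq_eq_withDensity (n : ℕ) {v : ℝ} (hv : 0 < v) :
    gaussianSeq n v = volume.withDensity fun x => ENNReal.ofReal (seqPDF n v x) := by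
  have hv' : v.toNNReal ≠ 0 := by simpa using hv
  have hg := gaussianReal_of_var_ne_zero 0 hv'
  have : SigmaFinite (volume.withDensity (gaussianPDF 0 v.toNNReal)) := by
    rw [← hg]; infer_instance
  unfold gaussianSeq seqPDF
  simp_rw [hg]
  rw [pi_withDensity_eq volume (measurable_gaussianPDF _ _)]
  simp_rw [ENNReal.ofReal_prod_of_nonneg fun i _ => gaussianPDFReal_nonneg _ _ _]
  rfl

theorem gaussianSeqs_eq_withDensity (K n : ℕ) {v : ℝ} (hv : 0 < v) :
    gaussianSeqs K n v =
      volume.withDensity fun s => ∏ k, ENNReal.ofReal (seqPDF n v (s k)) := by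
  have : SigmaFinite ((volume : Measure (Fin n → ℝ)).withDensity
      fun x => ENNReal.ofReal (seqPDF n v x)) := by
    rw [← gaussianSeq_eq_withDensity n hv]; infer_instance
  change (Measure.pi fun _ : Fin K => gaussianSeq n v) = _
  simp_rw [gaussianSeq_eq_withDensity n hv]
  rw [pi_withDensity_eq volume (by fun_prop)]
  rfl

theorem lintegral_seqPDF (n : ℕ) {v : ℝ} (hv : 0 < v) :
    ∫⁻ x, ENNReal.ofReal (seqPDF n v x) = 1 := by
  have h : gaussianSeq n v Set.univ = 1 := measure_univ
  rw [gaussianSeq_eq_withDensity n hv] at h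
  simpa using h

theorem memLp_eval_gaussianSeq {n : ℕ} (v : ℝ) (i : Fin n) :
    MemLp (fun x : Fin n → ℝ => x i) 2 (gaussianSeq n v) :=
  (memLp_id_gaussianReal (μ := 0) (v := v.toNNReal) 2).comp_measurePreserving
    (measurePreserving_eval (fun _ : Fin n => gaussianReal 0 v.toNNReal) i)

theorem integral_eval_gaussianSeq {n : ℕ} (v : ℝ) (i : Fin n) :
    ∫ x, x i ∂(gaussianSeq n v) = 0 := by
  rw [integral_eval]; simp

theorem integral_sq_eval_gaussianSeq {n : ℕ} {v : ℝ} (hv : 0 ≤ v) (i : Fin n) :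
    ∫ x, x i ^ 2 ∂(gaussianSeq n v) = v := by
  rw [gaussianSeq, integral_comp_eval (X := fun _ : Fin n => ℝ) (f := fun y : ℝ => y ^ 2)
    (Measurable.aestronglyMeasurable (by fun_prop))]
  have h := variance_of_integral_eq_zero (μ := gaussianReal 0 v.toNNReal) (X := fun x => x)
    aemeasurable_id integral_id_gaussianReal
  rw [variance_fun_id_gaussianReal] at h
  rw [← h, Real.coe_toNNReal v hv]

theorem integral_sum_sq_gaussianSeq {n : ℕ} {v : ℝ} (hv : 0 ≤ v) :
    ∫ x, ∑ i, x i ^ 2 ∂(gaussianSeq n v) = n * v := by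
  rw [integral_finsetSum _ fun i _ => (memLp_eval_gaussianSeq v i).integrable_sq]
  simp [integral_sq_eval_gaussianSeq hv]

/-- The second moment of a fixed sequence plus Gaussian noise. -/
theorem integral_sum_add_sq_gaussianSeq {n : ℕ} {v : ℝ} (hv : 0 ≤ v) (b : Fin n → ℝ) :
    ∫ x, ∑ i, (b i + x i) ^ 2 ∂(gaussianSeq n v) = ∑ i, b i ^ 2 + n * v := by
  have hi : ∀ i, Integrable (fun x : Fin n → ℝ => x i) (gaussianSeq n v) := fun i =>
    (memLp_eval_gaussianSeq v i).integrable (by norm_num)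
  have hs : ∀ i, Integrable (fun x : Fin n → ℝ => x i ^ 2) (gaussianSeq n v) := fun i =>
    (memLp_eval_gaussianSeq v i).integrable_sq
  have h : ∀ i, ∫ x, (b i + x i) ^ 2 ∂(gaussianSeq n v) = b i ^ 2 + v := by
    intro i
    have : ∀ x : Fin n → ℝ, (b i + x i) ^ 2 = (b i ^ 2 + 2 * b i * x i) + x i ^ 2 := fun x => by ring
    simp_rw [this]
    rw [integral_add (f := fun x : Fin n → ℝ => b i ^ 2 + 2 * b i * x i)
        ((integrable_const _).add ((hi i).const_mul _)) (hs i),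
      integral_add (integrable_const _) ((hi i).const_mul _), integral_const_mul,
      integral_eval_gaussianSeq, integral_sq_eval_gaussianSeq hv]
    simp
  rw [integral_finsetSum _ fun i _ => ?_]
  · simp [h, Finset.sum_add_distrib]
  · exact (((memLp_const (b i)).add (memLp_eval_gaussianSeq v i))).integrable_sq

theorem measurePreserving_eval_gaussianSeqs {K n : ℕ} (v : ℝ) (k : Fin K) :
    MeasurePreserving (fun s : Fin K → Fin n → ℝ => s k) (gaussianSeqs K n v) (gaussianSeq n v) :=
  measurePreserving_eval (fun _ : Fin K => gaussianSeq n v) k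

theorem memLp_eval_gaussianSeqs {K n : ℕ} (v : ℝ) (k : Fin K) (i : Fin n) :
    MemLp (fun s : Fin K → Fin n → ℝ => s k i) 2 (gaussianSeqs K n v) :=
  (memLp_eval_gaussianSeq v i).comp_measurePreserving (measurePreserving_eval_gaussianSeqs v k)

theorem integral_sum_sq_gaussianSeqs {K n : ℕ} {v : ℝ} (hv : 0 ≤ v) (k : Fin K) :
    ∫ s, ∑ i, s k i ^ 2 ∂(gaussianSeqs K n v) = n * v := by
  rw [← integral_sum_sq_gaussianSeq hv,
    ← (measurePreserving_eval_gaussianSeqs v k).map_eq,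
      integral_map (measurePreserving_eval_gaussianSeqs v k).aemeasurable
      (Measurable.aestronglyMeasurable (by fun_prop))]

/-- The second moment of the sum of the interferences. -/
theorem integral_sum_sum_sq_gaussianSeqs {K n : ℕ} {v : ℝ} (hv : 0 ≤ v) :
    ∫ s, ∑ i, (∑ k, s k i) ^ 2 ∂(gaussianSeqs K n v) = n * (K * v) := by
  have hm : ∀ i : Fin n, MemLp (fun s : Fin K → Fin n → ℝ => ∑ k, s k i) 2 (gaussianSeqs K n v) :=
    fun i => memLp_finsetSum _ fun k _ => memLp_eval_gaussianSeqs v k i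
  have h : ∀ i : Fin n, ∫ s, (∑ k, s k i) ^ 2 ∂(gaussianSeqs K n v) = K * v := by
    intro i
    have h0 : ∫ s, ∑ k, s k i ∂(gaussianSeqs K n v) = 0 := by
      rw [integral_finsetSum _ fun k _ => (memLp_eval_gaussianSeqs v k i).integrable (by norm_num)]
      refine Finset.sum_eq_zero fun k _ => ?_
      rw [← integral_eval_gaussianSeq v i, ← (measurePreserving_eval_gaussianSeqs v k).map_eq,
        integral_map (measurePreserving_eval_gaussianSeqs v k).aemeasurable
          (Measurable.aestronglyMeasurable (by fun_prop))]
    rw [← variance_of_integral_eq_zero (hm i).aemeasurable h0]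
    have hv1 : Var[fun x : Fin n → ℝ => x i; gaussianSeq n v] = v := by
      rw [variance_of_integral_eq_zero (memLp_eval_gaussianSeq v i).aemeasurable
        (integral_eval_gaussianSeq v i), integral_sq_eval_gaussianSeq hv]
    have := variance_sum_pi (μ := fun _ : Fin K => gaussianSeq n v)
      (X := fun _ x => x i) fun _ => memLp_eval_gaussianSeq v i
    simp only [hv1] at this
    simp at this
    rw [← this]
    unfold gaussianSeqs
    congr 1
    ext s
    simp
  rw [integral_finsetSum _ fun i _ => (hm i).integrable_sq]
  simp [h]

/-! ### The converse -/

/-- Jensen's inequality for the logarithm of a positive function with bounded integral. -/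
theorem integral_log_le_log {Ω : Type*} [MeasurableSpace Ω] {μ : Measure Ω}
    [IsProbabilityMeasure μ] {g : Ω → ℝ} (hg : Measurable g) (hpos : ∀ ω, 0 < g ω)
    (hlog : Integrable (fun ω => Real.log (g ω)) μ) {C : ℝ} (hC : 0 < C)
    (hint : ∫⁻ ω, ENNReal.ofReal (g ω) ∂μ ≤ ENNReal.ofReal C) :
    ∫ ω, Real.log (g ω) ∂μ ≤ Real.log C := by
  have hgi : Integrable g μ := by
    refine ⟨hg.aestronglyMeasurable, ?_⟩
    rw [hasFiniteIntegral_iff_ofReal (ae_of_all _ fun ω => (hpos ω).le)]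
    exact hint.trans_lt ENNReal.ofReal_lt_top
  have hgC : ∫ ω, g ω ∂μ ≤ C := by
    rw [integral_eq_lintegral_of_nonneg_ae (ae_of_all _ fun ω => (hpos ω).le)
      hg.aestronglyMeasurable]
    exact ENNReal.toReal_le_of_le_ofReal hC.le hint
  -- The tangent line of the logarithm at `C`.
  have h : ∀ ω, Real.log (g ω) ≤ g ω / C + (Real.log C - 1) := by
    intro ω
    have := Real.log_le_sub_one_of_pos (div_pos (hpos ω) hC)
    rw [Real.log_div (hpos ω).ne' hC.ne'] at this
    linarith
  calc ∫ ω, Real.log (g ω) ∂μ ≤ ∫ ω, (g ω / C + (Real.log C - 1)) ∂μ :=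
        integral_mono hlog ((hgi.div_const C).add (integrable_const _)) h
    _ = (∫ ω, g ω ∂μ) / C + (Real.log C - 1) := by
        rw [integral_add (hgi.div_const C) (integrable_const _), integral_div]
        simp
    _ ≤ 1 + (Real.log C - 1) := by
        gcongr
        exact (div_le_one hC).2 hgC
    _ = Real.log C := by ring

/-! ### Change of measure from the true law to a Gaussian test law. -/

section ChangeOfMeasure

variable {K n : ℕ}

/-- The output sequences `f(s) + s_k + z` when all receivers see the same noise `z`. -/
def commonOutput (f : (Fin K → Fin n → ℝ) → Fin n → ℝ)
    (p : (Fin K → Fin n → ℝ) × (Fin n → ℝ)) (k : Fin K) : Fin n → ℝ :=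
  fun i => f p.1 i + p.2 i + p.1 k i

/-- The deviation of the noisy input `f(s) + z` from its estimate `m` given the outputs. -/
def inputDeviation (f m : (Fin K → Fin n → ℝ) → Fin n → ℝ)
    (p : (Fin K → Fin n → ℝ) × (Fin n → ℝ)) : Fin n → ℝ :=
  fun i => f p.1 i + p.2 i - m (commonOutput f p) i

theorem measurable_commonOutput {f : (Fin K → Fin n → ℝ) → Fin n → ℝ} (hf : Measurable f) :
    Measurable (commonOutput f) := by
  unfold commonOutput
  fun_prop

theorem measurable_inputDeviation {f m : (Fin K → Fin n → ℝ) → Fin n → ℝ} (hf : Measurable f)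
    (hm : Measurable m) : Measurable (inputDeviation f m) := by
  have := measurable_commonOutput hf
  unfold inputDeviation
  fun_prop

/-- The density of a test law of the interferences and the noise relative to the true law, weighted
by functions of the outputs: under the test law the outputs are independent Gaussian sequences of
power `σ`, and the noisy input deviates from the estimate `m` by a Gaussian of power `v`. -/
noncomputable def testRatio (f m : (Fin K → Fin n → ℝ) → Fin n → ℝ)
    (H : Fin K → (Fin n → ℝ) → ℝ) (Q σ v : ℝ) (p : (Fin K → Fin n → ℝ) × (Fin n → ℝ)) : ℝ :=
  (∏ k, H k (commonOutput f p k) * seqPDF n σ (commonOutput f p k)) *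
    seqPDF n v (inputDeviation f m p) / ((∏ k, seqPDF n Q (p.1 k)) * seqPDF n 1 p.2)

theorem measurable_testRatio {f m : (Fin K → Fin n → ℝ) → Fin n → ℝ} (hf : Measurable f)
    (hm : Measurable m) {H : Fin K → (Fin n → ℝ) → ℝ} (hH : ∀ k, Measurable (H k)) (Q σ v : ℝ) :
    Measurable (testRatio f m H Q σ v) := by
  have h1 := measurable_commonOutput hf
  have h2 := measurable_inputDeviation hf hm
  unfold testRatio
  fun_prop

theorem testRatio_pos {f m : (Fin K → Fin n → ℝ) → Fin n → ℝ} {H : Fin K → (Fin n → ℝ) → ℝ}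
    (hH : ∀ k y, 0 < H k y) {Q σ v : ℝ} (hQ : 0 < Q) (hσ : 0 < σ) (hv : 0 < v)
    (p : (Fin K → Fin n → ℝ) × (Fin n → ℝ)) : 0 < testRatio f m H Q σ v p :=
  div_pos (mul_pos (Finset.prod_pos fun k _ => mul_pos (hH k _) (seqPDF_pos hσ _))
    (seqPDF_pos hv _))
    (mul_pos (Finset.prod_pos fun _ _ => seqPDF_pos hQ _) (seqPDF_pos one_pos _))

/-- In the coordinates `(y, a)` the test density is a product over `k` of functions of `y k`, times
a normalized Gaussian in `a` centred at `m y`. Passing to these coordinates takes only translations,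
so an arbitrary measurable encoder contributes no Jacobian. -/
theorem lintegral_testRatio {f m : (Fin K → Fin n → ℝ) → Fin n → ℝ} (hf : Measurable f)
    (hm : Measurable m) {H : Fin K → (Fin n → ℝ) → ℝ} (hH : ∀ k, Measurable (H k))
    (hH0 : ∀ k y, 0 < H k y) {Q σ v : ℝ} (hQ : 0 < Q) (hσ : 0 < σ) (hv : 0 < v) :
    ∫⁻ p, ENNReal.ofReal (testRatio f m H Q σ v p)
        ∂((gaussianSeqs K n Q).prod (gaussianSeq n 1)) =
      ∏ k, ∫⁻ y, ENNReal.ofReal (H k y) ∂(gaussianSeq n σ) := by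
  let B : (Fin K → Fin n → ℝ) → ℝ≥0∞ := fun y => ∏ k, ENNReal.ofReal (H k (y k) * seqPDF n σ (y k))
  let A : (Fin n → ℝ) → (Fin K → Fin n → ℝ) → ℝ≥0∞ := fun a y =>
    B y * ENNReal.ofReal (seqPDF n v (a - m y))
  have hB : Measurable B := by fun_prop
  -- The true density cancels the denominator of the ratio; what remains is a function of the noisy
  -- input and the outputs alone.
  have hpoint : ∀ p : (Fin K → Fin n → ℝ) × (Fin n → ℝ),
      (∏ k, ENNReal.ofReal (seqPDF n Q (p.1 k))) * ENNReal.ofReal (seqPDF n 1 p.2) *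
        ENNReal.ofReal (testRatio f m H Q σ v p) =
      A (f p.1 + p.2) (p.1 + fun _ => f p.1 + p.2) := by
    intro p
    have hy : commonOutput f p = p.1 + fun _ => f p.1 + p.2 := by
      ext k i; simp [commonOutput]; ring
    have ha : inputDeviation f m p = f p.1 + p.2 - m (p.1 + fun _ => f p.1 + p.2) := by
      ext i; simp [inputDeviation, hy]
    have hpos : 0 < (∏ k, seqPDF n Q (p.1 k)) * seqPDF n 1 p.2 :=
      mul_pos (Finset.prod_pos fun k _ => seqPDF_pos hQ _) (seqPDF_pos one_pos _)
    have hnn : ∀ k, 0 ≤ H k (commonOutput f p k) * seqPDF n σ (commonOutput f p k) := fun k =>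
      mul_nonneg (hH0 _ _).le (seqPDF_pos hσ _).le
    rw [← ENNReal.ofReal_prod_of_nonneg fun k _ => (seqPDF_pos hQ _).le,
      ← ENNReal.ofReal_mul (Finset.prod_nonneg fun k _ => (seqPDF_pos hQ _).le),
      ← ENNReal.ofReal_mul hpos.le, testRatio, mul_div_cancel₀ _ hpos.ne',
      ENNReal.ofReal_mul (Finset.prod_nonneg fun k _ => hnn k),
      ENNReal.ofReal_prod_of_nonneg fun k _ => hnn k, ha, hy]
  rw [gaussianSeqs_eq_withDensity K n hQ, gaussianSeq_eq_withDensity n one_pos]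
  have : SigmaFinite ((volume : Measure (Fin n → ℝ)).withDensity
      fun x => ENNReal.ofReal (seqPDF n 1 x)) := by
    rw [← gaussianSeq_eq_withDensity n one_pos]; infer_instance
  rw [prod_withDensity (by fun_prop) (by fun_prop), lintegral_withDensity_eq_lintegral_mul _
    (by fun_prop) (measurable_testRatio hf hm hH Q σ v).ennreal_ofReal]
  calc ∫⁻ p : (Fin K → Fin n → ℝ) × (Fin n → ℝ),
        ((fun z : (Fin K → Fin n → ℝ) × (Fin n → ℝ) => (∏ k, ENNReal.ofReal (seqPDF n Q (z.1 k))) *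
          ENNReal.ofReal (seqPDF n 1 z.2)) *
          fun p => ENNReal.ofReal (testRatio f m H Q σ v p)) p ∂(volume.prod volume)
      = ∫⁻ p : (Fin K → Fin n → ℝ) × (Fin n → ℝ),
          A (f p.1 + p.2) (p.1 + fun _ => f p.1 + p.2) ∂(volume.prod volume) :=
        lintegral_congr fun p => hpoint p
    _ = ∫⁻ s : Fin K → Fin n → ℝ, ∫⁻ z : Fin n → ℝ, A (f s + z) (s + fun _ => f s + z) := by
        rw [lintegral_prod]
        exact (Measurable.aemeasurable (by fun_prop))
    -- For fixed `s` substitute `a = f s + z`; after exchanging the integrals, for fixed `a`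
    -- substitute `y k = s k + a`.
    _ = ∫⁻ s : Fin K → Fin n → ℝ, ∫⁻ a : Fin n → ℝ, A a (s + fun _ => a) :=
        lintegral_congr fun s => lintegral_add_left_eq_self (fun a => A a (s + fun _ => a)) (f s)
    _ = ∫⁻ a : Fin n → ℝ, ∫⁻ s : Fin K → Fin n → ℝ, A a (s + fun _ => a) :=
        lintegral_lintegral_swap (Measurable.aemeasurable (by unfold Function.uncurry; fun_prop))
    _ = ∫⁻ a : Fin n → ℝ, ∫⁻ y : Fin K → Fin n → ℝ, A a y :=
        lintegral_congr fun a => lintegral_add_right_eq_self (fun y => A a y) (fun _ => a)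
    _ = ∫⁻ y : Fin K → Fin n → ℝ, ∫⁻ a : Fin n → ℝ, A a y :=
        lintegral_lintegral_swap (Measurable.aemeasurable (by unfold Function.uncurry; fun_prop))
    _ = ∫⁻ y, B y := by
        refine lintegral_congr fun y => ?_
        rw [lintegral_const_mul _ (by fun_prop), lintegral_sub_right_eq_self
          (fun a => ENNReal.ofReal (seqPDF n v a)), lintegral_seqPDF n hv, mul_one]
    _ = ∏ k, ∫⁻ y, ENNReal.ofReal (H k y) ∂(gaussianSeq n σ) := by
        rw [volume_pi, lintegral_pi_prod_eq_prod (f := fun k y =>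
          ENNReal.ofReal (H k y * seqPDF n σ y)) volume (by fun_prop)]
        refine Finset.prod_congr rfl fun k _ => ?_
        rw [gaussianSeq_eq_withDensity n hσ, lintegral_withDensity_eq_lintegral_mul _
          (by fun_prop) (hH k).ennreal_ofReal]
        refine lintegral_congr fun y => ?_
        rw [Pi.mul_apply, mul_comm, ENNReal.ofReal_mul (seqPDF_pos hσ _).le]

/-- Every Gaussian factor contributes a quadratic form and a constant. The constants `log (2π)`
cancel, since numerator and denominator both consist of `K + 1` Gaussian sequences of length `n`. -/
theorem log_testRatio {f m : (Fin K → Fin n → ℝ) → Fin n → ℝ} {H : Fin K → (Fin n → ℝ) → ℝ}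
    (hH : ∀ k y, 0 < H k y) {Q σ v : ℝ} (hQ : 0 < Q) (hσ : 0 < σ) (hv : 0 < v)
    (p : (Fin K → Fin n → ℝ) × (Fin n → ℝ)) :
    Real.log (testRatio f m H Q σ v p) =
      (∑ k, Real.log (H k (commonOutput f p k))
        - (∑ k, ∑ i, commonOutput f p k i ^ 2) / (2 * σ)
        - (∑ i, inputDeviation f m p i ^ 2) / (2 * v)
        + ((∑ k, ∑ i, p.1 k i ^ 2) / (2 * Q) + (∑ i, p.2 i ^ 2) / 2))
      - (K * (n / 2) * (Real.log σ - Real.log Q) + n / 2 * Real.log v) := by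
  have hs := fun k => seqPDF_pos hσ (commonOutput f p k)
  have hq := fun k => seqPDF_pos hQ (p.1 k)
  rw [testRatio, Real.log_div
    (mul_pos (Finset.prod_pos fun k _ => mul_pos (hH k _) (hs k)) (seqPDF_pos hv _)).ne'
    (mul_pos (Finset.prod_pos fun k _ => hq k) (seqPDF_pos one_pos _)).ne',
    Real.log_mul (Finset.prod_pos fun k _ => mul_pos (hH k _) (hs k)).ne' (seqPDF_pos hv _).ne',
    Real.log_mul (Finset.prod_pos fun k _ => hq k).ne' (seqPDF_pos one_pos _).ne',
    Real.log_prod fun k _ => (mul_pos (hH k _) (hs k)).ne', Real.log_prod fun k _ => (hq k).ne']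
  have h1 : ∀ k, Real.log (H k (commonOutput f p k) * seqPDF n σ (commonOutput f p k)) =
      Real.log (H k (commonOutput f p k)) + Real.log (seqPDF n σ (commonOutput f p k)) := fun k =>
    Real.log_mul (hH k _).ne' (hs k).ne'
  have h2 : ∀ x : ℝ, 0 < x → Real.log (2 * Real.pi * x) = Real.log (2 * Real.pi) + Real.log x :=
    fun x hx => Real.log_mul (by positivity) hx.ne'
  simp_rw [h1, log_seqPDF hσ, log_seqPDF hQ, log_seqPDF hv, log_seqPDF one_pos, h2 σ hσ, h2 Q hQ,
    h2 v hv, h2 1 one_pos, Finset.sum_add_distrib, Finset.sum_sub_distrib, Finset.sum_div]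
  simp
  ring

end ChangeOfMeasure

/-! ### Second moments and the resulting entropy inequality. -/

section Moments

variable {K n : ℕ}

theorem memLp_commonOutput {f : (Fin K → Fin n → ℝ) → Fin n → ℝ} {Q : ℝ}
    (hf2 : ∀ i, MemLp (fun s => f s i) 2 (gaussianSeqs K n Q)) (k : Fin K) (i : Fin n) :
    MemLp (fun p => commonOutput f p k i) 2 ((gaussianSeqs K n Q).prod (gaussianSeq n 1)) :=
  (((hf2 i).comp_fst _).add ((memLp_eval_gaussianSeq 1 i).comp_snd _)).add
    ((memLp_eval_gaussianSeqs Q k i).comp_fst _)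

/-- The weights of the test law are bounded on average by the relative entropy between the true law
and the test law. -/
theorem sum_integral_log_le {f m : (Fin K → Fin n → ℝ) → Fin n → ℝ} (hf : Measurable f)
    (hm : Measurable m) {H : Fin K → (Fin n → ℝ) → ℝ} (hH : ∀ k, Measurable (H k))
    {C : ℝ} (hH1 : ∀ k y, 1 ≤ H k y) (hHC : ∀ k y, H k y ≤ C)
    {Q σ v : ℝ} (hQ : 0 < Q) (hσ : 0 < σ) (hv : 0 < v)
    (hf2 : ∀ i, MemLp (fun s => f s i) 2 (gaussianSeqs K n Q))
    (hd : ∀ i, MemLp (fun p => inputDeviation f m p i) 2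
      ((gaussianSeqs K n Q).prod (gaussianSeq n 1))) :
    ∑ k, ∫ p, Real.log (H k (commonOutput f p k)) ∂((gaussianSeqs K n Q).prod (gaussianSeq n 1)) ≤
      ∑ k, Real.log (∫ y, H k y ∂(gaussianSeq n σ))
      + (∑ k, ∫ p, ∑ i, commonOutput f p k i ^ 2
          ∂((gaussianSeqs K n Q).prod (gaussianSeq n 1))) / (2 * σ)
      + (∫ p, ∑ i, inputDeviation f m p i ^ 2
          ∂((gaussianSeqs K n Q).prod (gaussianSeq n 1))) / (2 * v)
      - (K * n / 2 + n / 2)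
      + (K * (n / 2) * (Real.log σ - Real.log Q) + n / 2 * Real.log v) := by
  set μ := (gaussianSeqs K n Q).prod (gaussianSeq n 1) with hμ
  have hH0 : ∀ k y, 0 < H k y := fun k y => one_pos.trans_le (hH1 k y)
  have hcm := measurable_commonOutput hf
  have i1 : ∀ k, Integrable (fun p => Real.log (H k (commonOutput f p k))) μ := by
    intro k
    refine Integrable.of_bound (C := Real.log C)
      (Measurable.aestronglyMeasurable (by fun_prop)) (ae_of_all _ fun p => ?_)
    rw [Real.norm_of_nonneg (Real.log_nonneg (hH1 _ _))]
    exact Real.log_le_log (hH0 _ _) (hHC _ _)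
  have i2 : ∀ k, Integrable (fun p => ∑ i, commonOutput f p k i ^ 2) μ := fun k =>
    integrable_finsetSum _ fun i _ => (memLp_commonOutput hf2 k i).integrable_sq
  have i3 : Integrable (fun p => ∑ i, inputDeviation f m p i ^ 2) μ :=
    integrable_finsetSum _ fun i _ => (hd i).integrable_sq
  have i4 : ∀ k, Integrable (fun p : (Fin K → Fin n → ℝ) × (Fin n → ℝ) => ∑ i, p.1 k i ^ 2) μ :=
    fun k => integrable_finsetSum _ fun i _ =>
      ((memLp_eval_gaussianSeqs Q k i).comp_fst (gaussianSeq n 1)).integrable_sq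
  have i5 : Integrable (fun p : (Fin K → Fin n → ℝ) × (Fin n → ℝ) => ∑ i, p.2 i ^ 2) μ :=
    integrable_finsetSum _ fun i _ =>
      ((memLp_eval_gaussianSeq 1 i).comp_snd (gaussianSeqs K n Q)).integrable_sq
  have j1 := integrable_finsetSum Finset.univ fun k _ => i1 k
  have j2 := (integrable_finsetSum Finset.univ fun k _ => i2 k).div_const (2 * σ)
  have j3 := i3.div_const (2 * v)
  have j4 := (integrable_finsetSum Finset.univ fun k _ => i4 k).div_const (2 * Q)
  have j5 := i5.div_const 2
  have e4 : ∀ k, ∫ p : (Fin K → Fin n → ℝ) × (Fin n → ℝ), ∑ i, p.1 k i ^ 2 ∂μ = n * Q := by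
    intro k
    rw [hμ, integral_fun_fst (fun s : Fin K → Fin n → ℝ => ∑ i, s k i ^ 2),
      integral_sum_sq_gaussianSeqs hQ.le]
    simp
  have e5 : ∫ p : (Fin K → Fin n → ℝ) × (Fin n → ℝ), ∑ i, p.2 i ^ 2 ∂μ = n := by
    rw [hμ, integral_fun_snd (fun z : Fin n → ℝ => ∑ i, z i ^ 2),
      integral_sum_sq_gaussianSeq zero_le_one]
    simp
  have hHi : ∀ k, Integrable (H k) (gaussianSeq n σ) := fun k =>
    Integrable.of_bound (C := C) (hH k).aestronglyMeasurable (ae_of_all _ fun y => by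
      rw [Real.norm_of_nonneg (hH0 k y).le]; exact hHC k y)
  have hHI : ∀ k, 0 < ∫ y, H k y ∂(gaussianSeq n σ) := fun k => by
    refine one_pos.trans_le ?_
    calc (1 : ℝ) = ∫ y, 1 ∂(gaussianSeq n σ) := by simp
      _ ≤ _ := integral_mono (integrable_const _) (hHi k) (hH1 k)
  have hlogint : Integrable (fun p => Real.log (testRatio f m H Q σ v p)) μ := by
    simp_rw [log_testRatio hH0 hQ hσ hv]
    exact (((j1.sub j2).sub j3).add (j4.add j5)).sub (integrable_const _)
  have hJ := integral_log_le_log (measurable_testRatio hf hm hH Q σ v)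
    (testRatio_pos hH0 hQ hσ hv) hlogint (C := ∏ k, ∫ y, H k y ∂(gaussianSeq n σ))
    (Finset.prod_pos fun k _ => hHI k) (by
      rw [hμ, lintegral_testRatio hf hm hH hH0 hQ hσ hv,
        ENNReal.ofReal_prod_of_nonneg fun k _ => (hHI k).le]
      refine (Finset.prod_congr rfl fun k _ => ?_).le
      rw [ofReal_integral_eq_lintegral_ofReal (hHi k) (ae_of_all _ fun y => (hH0 k y).le)])
  rw [Real.log_prod fun k _ => (hHI k).ne'] at hJ
  simp_rw [log_testRatio hH0 hQ hσ hv] at hJ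
  have hsplit : ∀ {a₁ a₂ a₃ a₄ a₅ : (Fin K → Fin n → ℝ) × (Fin n → ℝ) → ℝ} {c : ℝ},
      Integrable a₁ μ → Integrable a₂ μ → Integrable a₃ μ → Integrable a₄ μ → Integrable a₅ μ →
      ∫ p, (a₁ p - a₂ p - a₃ p + (a₄ p + a₅ p) - c) ∂μ =
        ∫ p, a₁ p ∂μ - ∫ p, a₂ p ∂μ - ∫ p, a₃ p ∂μ + (∫ p, a₄ p ∂μ + ∫ p, a₅ p ∂μ) - c := by
    intro a₁ a₂ a₃ a₄ a₅ c h₁ h₂ h₃ h₄ h₅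
    have e₁ := integral_sub (((h₁.sub h₂).sub h₃).add (h₄.add h₅)) (integrable_const c)
    have e₂ := integral_add ((h₁.sub h₂).sub h₃) (h₄.add h₅)
    have e₃ := integral_sub (h₁.sub h₂) h₃
    simp only [Pi.add_apply, Pi.sub_apply] at e₁ e₂ e₃
    rw [e₁, e₂, e₃, integral_add h₄ h₅, integral_sub h₁ h₂]
    simp
  rw [hsplit j1 j2 j3 j4 j5, integral_finsetSum _ fun k _ => i1 k, integral_div, integral_div,
    integral_div, integral_div, integral_finsetSum _ fun k _ => i2 k,
    integral_finsetSum _ fun k _ => i4 k, e5] at hJ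
  simp_rw [e4] at hJ
  simp only [Finset.sum_const, Finset.card_univ,
    Fintype.card_fin, nsmul_eq_mul] at hJ
  have hQ2 : (K : ℝ) * (n * Q) / (2 * Q) = K * n / 2 := by field_simp
  rw [hQ2] at hJ
  linarith

theorem integral_prod_gaussianSeqs {f : (Fin K → Fin n → ℝ) → Fin n → ℝ} {Q : ℝ}
    (hf2 : ∀ i, MemLp (fun s => f s i) 2 (gaussianSeqs K n Q)) :
    ∫ p, ∑ i, (f p.1 i + p.2 i) ^ 2 ∂((gaussianSeqs K n Q).prod (gaussianSeq n 1)) =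
      ∫ s, ∑ i, f s i ^ 2 ∂(gaussianSeqs K n Q) + n := by
  rw [integral_prod]
  · simp_rw [integral_sum_add_sq_gaussianSeq zero_le_one]
    rw [integral_add (integrable_finsetSum _ fun i _ => (hf2 i).integrable_sq)
      (integrable_const _)]
    simp
  · exact integrable_finsetSum _ fun i _ => (((hf2 i).comp_fst (gaussianSeq n 1)).add
      ((memLp_eval_gaussianSeq 1 i).comp_snd (gaussianSeqs K n Q))).integrable_sq

/-- The output power is at most `(1 + t)` times the input power, `(1 + 1 / t)` times the
interference power, and the noise power. -/
theorem integral_sum_sq_commonOutput_le {f : (Fin K → Fin n → ℝ) → Fin n → ℝ} {Q t : ℝ}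
    (hQ : 0 ≤ Q) (ht : 0 < t) (hf2 : ∀ i, MemLp (fun s => f s i) 2 (gaussianSeqs K n Q))
    (k : Fin K) :
    ∫ p, ∑ i, commonOutput f p k i ^ 2 ∂((gaussianSeqs K n Q).prod (gaussianSeq n 1)) ≤
      (1 + t) * ∫ s, ∑ i, f s i ^ 2 ∂(gaussianSeqs K n Q) + (1 + 1 / t) * (n * Q) + n := by
  have hg : ∀ i, MemLp (fun s => f s i + s k i) 2 (gaussianSeqs K n Q) := fun i =>
    (hf2 i).add (memLp_eval_gaussianSeqs Q k i)
  have h1 : ∀ p : (Fin K → Fin n → ℝ) × (Fin n → ℝ), ∀ i,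
      commonOutput f p k i = (f p.1 i + p.1 k i) + p.2 i := fun p i => by
    rw [commonOutput]; ring
  simp_rw [h1]
  rw [integral_prod_gaussianSeqs (f := fun s i => f s i + s k i) hg]
  gcongr
  have i1 : Integrable (fun s => ∑ i, f s i ^ 2) (gaussianSeqs K n Q) :=
    integrable_finsetSum _ fun i _ => (hf2 i).integrable_sq
  have i2 : Integrable (fun s => ∑ i, s k i ^ 2) (gaussianSeqs K n Q) :=
    integrable_finsetSum _ fun i _ => (memLp_eval_gaussianSeqs Q k i).integrable_sq
  calc ∫ s, ∑ i, (f s i + s k i) ^ 2 ∂(gaussianSeqs K n Q)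
      ≤ ∫ s, ((1 + t) * ∑ i, f s i ^ 2 + (1 + 1 / t) * ∑ i, s k i ^ 2) ∂(gaussianSeqs K n Q) := by
        refine integral_mono (integrable_finsetSum _ fun i _ => (hg i).integrable_sq)
          ((i1.const_mul _).add (i2.const_mul _)) fun s => ?_
        simp only [Finset.mul_sum, ← Finset.sum_add_distrib]
        refine Finset.sum_le_sum fun i _ => ?_
        -- Young's inequality with a fixed weight `t`, in place of Cauchy–Schwarz, keeps the bound
        -- affine in the input energy. It can therefore be averaged over messages of unequal energy.
        have : (1 + t) * f s i ^ 2 + (1 + 1 / t) * s k i ^ 2 - (f s i + s k i) ^ 2 =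
            (t * f s i - s k i) ^ 2 / t := by field_simp; ring
        have h2 : 0 ≤ (t * f s i - s k i) ^ 2 / t := by positivity
        linarith
    _ = _ := by
        rw [integral_add (i1.const_mul _) (i2.const_mul _), integral_const_mul, integral_const_mul,
          integral_sum_sq_gaussianSeqs hQ]

end Moments

/-! ### Bounds on the number of messages at finite blocklength. -/

namespace Code

variable {K n M : ℕ}

/-- The error probability of a code when message `w` is sent. -/
noncomputable def messageErrorProb (c : Code K n M) (Q : ℝ) (w : Fin M) : ℝ :=
  ((gaussianSeqs K n Q).prod (gaussianSeqs K n 1)).real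
    {p | ∃ k, c.dec k (c.output w p.1 p.2 k) ≠ w}

theorem errorProb_eq (c : Code K n M) (Q : ℝ) :
    c.errorProb Q = (M : ℝ)⁻¹ * ∑ w, c.messageErrorProb Q w := rfl

theorem errorProb_nonneg (c : Code K n M) (Q : ℝ) : 0 ≤ c.errorProb Q := by
  unfold errorProb; positivity

/-- The constraint is only on the average over messages, but an average of finitely many terms is
finite only if each is. This makes every input square-integrable. -/
theorem PowerConstraint.lintegral_ne_top {c : Code K n M} {P Q : ℝ} (h : c.PowerConstraint P Q)
    (w : Fin M) :
    ∫⁻ s, ENNReal.ofReal (∑ i, c.enc w s i ^ 2) ∂(gaussianSeqs K n Q) ≠ ∞ := by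
  have h1 := ne_top_of_le_ne_top ENNReal.ofReal_ne_top h
  have h2 : ∑ w, ∫⁻ s, ENNReal.ofReal (∑ i, c.enc w s i ^ 2) ∂(gaussianSeqs K n Q) ≠ ∞ := by
    intro h3
    rw [h3, ENNReal.mul_top (by simp)] at h1
    exact h1 rfl
  exact ENNReal.sum_ne_top.1 h2 w (Finset.mem_univ w)

theorem PowerConstraint.memLp {c : Code K n M} {P Q : ℝ} (h : c.PowerConstraint P Q)
    (w : Fin M) (i : Fin n) : MemLp (fun s => c.enc w s i) 2 (gaussianSeqs K n Q) := by
  have hm := c.measurable_enc w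
  rw [memLp_two_iff_integrable_sq (Measurable.aestronglyMeasurable (by fun_prop))]
  refine ⟨Measurable.aestronglyMeasurable (by fun_prop), ?_⟩
  rw [hasFiniteIntegral_iff_ofReal (ae_of_all _ fun s => sq_nonneg _)]
  refine (lintegral_mono fun s => ?_).trans_lt (h.lintegral_ne_top w).lt_top
  exact ENNReal.ofReal_le_ofReal
    (Finset.single_le_sum (f := fun i => c.enc w s i ^ 2) (fun i _ => sq_nonneg _)
      (Finset.mem_univ i))

theorem PowerConstraint.sum_integral_le {c : Code K n M} {P Q : ℝ} (hM : 0 < M) (hP : 0 ≤ P)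
    (h : c.PowerConstraint P Q) :
    ∑ w, ∫ s, ∑ i, c.enc w s i ^ 2 ∂(gaussianSeqs K n Q) ≤ M * (n * P) := by
  have h0 : ∀ w, 0 ≤ ∫ s, ∑ i, c.enc w s i ^ 2 ∂(gaussianSeqs K n Q) := fun w =>
    integral_nonneg fun s => by positivity
  have h1 : ∀ w, ∫⁻ s, ENNReal.ofReal (∑ i, c.enc w s i ^ 2) ∂(gaussianSeqs K n Q) =
      ENNReal.ofReal (∫ s, ∑ i, c.enc w s i ^ 2 ∂(gaussianSeqs K n Q)) := fun w =>
    (ofReal_integral_eq_lintegral_ofReal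
      (integrable_finsetSum _ fun i _ => (h.memLp w i).integrable_sq)
      (ae_of_all _ fun s => by positivity)).symm
  have h2 := h
  unfold PowerConstraint at h2
  simp_rw [h1] at h2
  rw [← ENNReal.ofReal_sum_of_nonneg fun w _ => h0 w,
    ENNReal.inv_mul_le_iff (by simpa using hM.ne') (by simp), ← ENNReal.ofReal_natCast,
    ← ENNReal.ofReal_mul (by positivity)] at h2
  exact (ENNReal.ofReal_le_ofReal_iff (by positivity)).1 h2

/-- Each receiver errs at most as often as the whole system, whatever the joint law of the
noises. -/
theorem measureReal_commonOutput_ne_le (c : Code K n M) (Q : ℝ) (w : Fin M) (k : Fin K) :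
    ((gaussianSeqs K n Q).prod (gaussianSeq n 1)).real
      {p | c.dec k (commonOutput (c.enc w) p k) ≠ w} ≤ c.messageErrorProb Q w := by
  -- Keeping only the noise of receiver `k` turns independent noises into the common-noise law, and
  -- the output of receiver `k` does not notice the difference.
  have hmp : MeasurePreserving
      (Prod.map id fun z : Fin K → Fin n → ℝ => z k)
      ((gaussianSeqs K n Q).prod (gaussianSeqs K n 1))
      ((gaussianSeqs K n Q).prod (gaussianSeq n 1)) :=
    (MeasurePreserving.id _).prod (measurePreserving_eval_gaussianSeqs 1 k)
  have hm := measurable_commonOutput (c.measurable_enc w)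
  have hs : MeasurableSet {p | c.dec k (commonOutput (c.enc w) p k) ≠ w} := by
    have : Measurable fun p => c.dec k (commonOutput (c.enc w) p k) :=
      (c.measurable_dec k).comp (by fun_prop)
    exact this (measurableSet_singleton w).compl
  rw [← hmp.measureReal_preimage hs.nullMeasurableSet]
  refine measureReal_mono fun p hp => ⟨k, ?_⟩
  have : c.output w p.1 p.2 k = commonOutput (c.enc w) (p.1, p.2 k) k := by
    ext i; simp only [output, commonOutput]; ring
  rw [this]
  exact hp

/-- Fano's inequality and the change of measure, for an estimate `m` of the noisy input with
average squared deviation at most `v`. -/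
theorem log_card_le_of_deviation (c : Code K n M) (hM : 0 < M) {P Q t v : ℝ} (hP : 0 ≤ P)
    (hQ : 0 < Q) (ht : 0 < t) (hv : 0 < v) (hpow : c.PowerConstraint P Q)
    {m : (Fin K → Fin n → ℝ) → Fin n → ℝ} (hm : Measurable m)
    (hd : ∀ w i, MemLp (fun p => inputDeviation (c.enc w) m p i) 2
      ((gaussianSeqs K n Q).prod (gaussianSeq n 1)))
    (hdv : ∑ w, ∫ p, ∑ i, inputDeviation (c.enc w) m p i ^ 2
      ∂((gaussianSeqs K n Q).prod (gaussianSeq n 1)) ≤ M * (n * v)) :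
    K * (1 - c.errorProb Q) * Real.log M ≤
      K + n * (K / 2 * (Real.log ((1 + t) * P + (1 + 1 / t) * Q + 1) - Real.log Q) +
        1 / 2 * Real.log v) := by
  classical
  set σ := (1 + t) * P + (1 + 1 / t) * Q + 1 with hσd
  have hσ : 0 < σ := by positivity
  have hM1 : (1 : ℝ) ≤ M := by exact_mod_cast hM
  have hM0 : (0 : ℝ) < M := by exact_mod_cast hM
  -- The weight `M` on correct decoding replaces Fano's inequality. Under the true law the mean of
  -- `log H` is at least the success probability times `log M`. Under the test law, which does not
  -- know the message, correct decoding has probabilities `b w k` that sum to one over `w`.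
  let H : Fin M → Fin K → (Fin n → ℝ) → ℝ := fun w k y => if c.dec k y = w then (M : ℝ) else 1
  have hms : ∀ w k, MeasurableSet {y | c.dec k y = w} := fun w k =>
    c.measurable_dec k (measurableSet_singleton w)
  have hH : ∀ w k, Measurable (H w k) := fun w k =>
    Measurable.ite (hms w k) measurable_const measurable_const
  let e := c.messageErrorProb Q
  let b : Fin M → Fin K → ℝ := fun w k => (gaussianSeq n σ).real {y | c.dec k y = w}
  have hb : ∀ k, ∑ w, b w k = 1 := by
    intro k
    have h := sum_measureReal_preimage_singleton (μ := gaussianSeq n σ) (f := c.dec k) Finset.univ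
      (fun w _ => hms w k)
    simp only [Finset.coe_univ, Set.preimage_univ, probReal_univ] at h
    exact h
  have hHint : ∀ w k, ∫ y, H w k y ∂(gaussianSeq n σ) = 1 + (M - 1) * b w k := by
    intro w k
    have h1 : ∀ y, H w k y = 1 + {y | c.dec k y = w}.indicator (fun _ => (M : ℝ) - 1) y := by
      intro y
      by_cases hy : c.dec k y = w <;> simp [H, hy]
    simp_rw [h1]
    rw [integral_add (integrable_const _) ((integrable_const _).indicator (hms w k)),
      integral_indicator (hms w k)]
    simp [b, mul_comm]
  -- By `log (1 + u) ≤ u`. Summed over `w` this gives at most `M` per receiver, which is the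
  -- constant `K` in the conclusion after averaging.
  have hlogH : ∀ w k, Real.log (∫ y, H w k y ∂(gaussianSeq n σ)) ≤ (M - 1) * b w k := by
    intro w k
    have hb0 : 0 ≤ b w k := measureReal_nonneg
    have h1 : 0 ≤ (M - 1) * b w k := mul_nonneg (by linarith) hb0
    rw [hHint]
    linarith [Real.log_le_sub_one_of_pos (show 0 < 1 + (M - 1) * b w k by linarith)]
  have hsucc : ∀ w k, (1 - e w) * Real.log M ≤
      ∫ p, Real.log (H w k (commonOutput (c.enc w) p k))
        ∂((gaussianSeqs K n Q).prod (gaussianSeq n 1)) := by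
    intro w k
    have hcm := measurable_commonOutput (c.measurable_enc w)
    have hS : MeasurableSet {p | c.dec k (commonOutput (c.enc w) p k) = w} :=
      ((c.measurable_dec k).comp (show Measurable fun p => commonOutput (c.enc w) p k by fun_prop))
        (measurableSet_singleton w)
    have h1 : ∀ p, Real.log (H w k (commonOutput (c.enc w) p k)) =
        {p | c.dec k (commonOutput (c.enc w) p k) = w}.indicator (fun _ => Real.log M) p := by
      intro p
      by_cases hy : c.dec k (commonOutput (c.enc w) p k) = w <;> simp [H, hy]
    simp_rw [h1]
    rw [integral_indicator hS]
    simp only [integral_const, measureReal_restrict_apply_univ, smul_eq_mul]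
    refine mul_le_mul_of_nonneg_right ?_ (Real.log_nonneg hM1)
    have h2 := c.measureReal_commonOutput_ne_le Q w k
    have h3 : {p | c.dec k (commonOutput (c.enc w) p k) ≠ w} =
        {p | c.dec k (commonOutput (c.enc w) p k) = w}ᶜ := rfl
    rw [h3, probReal_compl_eq_one_sub hS] at h2
    linarith
  have hw : ∀ w, K * ((1 - e w) * Real.log M) ≤ ∑ k, (M - 1) * b w k
      + K * ((1 + t) * ∫ s, ∑ i, c.enc w s i ^ 2 ∂(gaussianSeqs K n Q)
          + ((1 + 1 / t) * (n * Q) + n)) / (2 * σ)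
      + (∫ p, ∑ i, inputDeviation (c.enc w) m p i ^ 2
          ∂((gaussianSeqs K n Q).prod (gaussianSeq n 1))) / (2 * v)
      + (K * (n / 2) * (Real.log σ - Real.log Q) + n / 2 * Real.log v
          - (K * n / 2 + n / 2)) := by
    intro w
    have h1 := sum_integral_log_le (c.measurable_enc w) hm (hH w) (C := M)
      (fun k y => by simp only [H]; split_ifs <;> simp [hM1])
      (fun k y => by simp only [H]; split_ifs <;> simp [hM1]) hQ hσ hv (hpow.memLp w) (hd w)
    have h2 := Finset.sum_le_sum fun k (_ : k ∈ Finset.univ) => hsucc w k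
    simp only [Finset.sum_const, Finset.card_univ, Fintype.card_fin, nsmul_eq_mul] at h2
    have h3 := Finset.sum_le_sum fun k (_ : k ∈ Finset.univ) => hlogH w k
    have h4 : (∑ k, ∫ p, ∑ i, commonOutput (c.enc w) p k i ^ 2
          ∂((gaussianSeqs K n Q).prod (gaussianSeq n 1))) ≤
        K * ((1 + t) * ∫ s, ∑ i, c.enc w s i ^ 2 ∂(gaussianSeqs K n Q)
          + ((1 + 1 / t) * (n * Q) + n)) := by
      have := Finset.sum_le_sum fun k (_ : k ∈ Finset.univ) =>
        integral_sum_sq_commonOutput_le hQ.le ht (hpow.memLp w) k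
      simp only [Finset.sum_const, Finset.card_univ, Fintype.card_fin, nsmul_eq_mul] at this
      linarith
    have h5 := div_le_div_of_nonneg_right h4 (show 0 ≤ 2 * σ by positivity)
    linarith
  have hsum := Finset.sum_le_sum fun w (_ : w ∈ Finset.univ) => hw w
  have hbs : ∑ w, ∑ k, ((M : ℝ) - 1) * b w k = (M - 1) * K := by
    rw [Finset.sum_comm]
    simp_rw [← Finset.mul_sum, hb]
    simp
  have he : ∑ w, (1 - e w) = M * (1 - c.errorProb Q) := by
    rw [errorProb_eq, Finset.sum_sub_distrib, mul_sub, mul_inv_cancel_left₀ hM0.ne']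
    simp [e]
  rw [← Finset.mul_sum, ← Finset.sum_mul, he, Finset.sum_add_distrib, Finset.sum_add_distrib,
    Finset.sum_add_distrib, hbs, ← Finset.sum_div, ← Finset.sum_div, ← Finset.mul_sum,
    Finset.sum_add_distrib, ← Finset.mul_sum] at hsum
  simp only [Finset.sum_const, Finset.card_univ, Fintype.card_fin, nsmul_eq_mul] at hsum
  have hp := hpow.sum_integral_le hM hP
  -- `σ` bounds the average output power, so the quadratic terms in the outputs total at most `K * n
  -- / 2` per message. The deviation adds at most `n / 2`, and together they are absorbed by the
  -- second moments of the true law.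
  have h1 : K * ((1 + t) * ∑ w, ∫ s, ∑ i, c.enc w s i ^ 2 ∂(gaussianSeqs K n Q)
          + M * ((1 + 1 / t) * (n * Q) + n)) / (2 * σ) ≤ M * (K * n / 2) := by
    rw [div_le_iff₀ (by positivity)]
    have : (M : ℝ) * (K * n / 2) * (2 * σ) =
        K * ((1 + t) * (M * (n * P)) + M * ((1 + 1 / t) * (n * Q) + n)) := by
      rw [hσd]; ring
    rw [this]
    gcongr
  have h2 := div_le_div_of_nonneg_right hdv (show 0 ≤ 2 * v by positivity)
  have h3 : (M : ℝ) * (n * v) / (2 * v) = M * (n / 2) := by field_simp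
  rw [h3] at h2
  have h4 : M * (K * (1 - c.errorProb Q) * Real.log M) ≤ M *
      (K + n * (K / 2 * (Real.log σ - Real.log Q) + 1 / 2 * Real.log v)) := by
    have hK0 : (0 : ℝ) ≤ K := by positivity
    linarith
  exact le_of_mul_le_mul_left h4 hM0

/-- Here the noisy input is estimated by zero, so its deviation is its own power, at most `P + 1`.
-/
theorem log_card_le_of_power (c : Code K n M) (hM : 0 < M) {P Q t : ℝ} (hP : 0 ≤ P)
    (hQ : 0 < Q) (ht : 0 < t) (hpow : c.PowerConstraint P Q) :
    K * (1 - c.errorProb Q) * Real.log M ≤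
      K + n * (K / 2 * (Real.log ((1 + t) * P + (1 + 1 / t) * Q + 1) - Real.log Q) +
        1 / 2 * Real.log (P + 1)) := by
  have hdev : ∀ w p i, inputDeviation (c.enc w) (fun _ _ => 0) p i = c.enc w p.1 i + p.2 i :=
    fun w p i => sub_zero _
  refine c.log_card_le_of_deviation hM hP hQ ht (by positivity) hpow (m := fun _ _ => 0)
    measurable_const (fun w i => ?_) ?_
  · simp_rw [hdev]
    exact ((hpow.memLp w i).comp_fst _).add ((memLp_eval_gaussianSeq 1 i).comp_snd _)
  · simp_rw [hdev, integral_prod_gaussianSeqs (hpow.memLp _)]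
    have := hpow.sum_integral_le hM hP
    simp only [Finset.sum_add_distrib, Finset.sum_const, Finset.card_univ, Fintype.card_fin,
      nsmul_eq_mul]
    linarith

/-- Here the noisy input is estimated by the average of the outputs. The deviation is minus the
average of `K` independent interferences, of power `Q / K`, independently of the encoder. -/
theorem log_card_le_of_interference (c : Code K n M) (hK : 0 < K) (hM : 0 < M) {P Q t : ℝ}
    (hP : 0 ≤ P) (hQ : 0 < Q) (ht : 0 < t) (hpow : c.PowerConstraint P Q) :
    K * (1 - c.errorProb Q) * Real.log M ≤
      K + n * (K / 2 * (Real.log ((1 + t) * P + (1 + 1 / t) * Q + 1) - Real.log Q) +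
        1 / 2 * Real.log (Q / K)) := by
  have hK0 : (0 : ℝ) < K := by exact_mod_cast hK
  have hdev : ∀ w p i, inputDeviation (c.enc w) (fun y i => (∑ k, y k i) / K) p i =
      -(∑ k, p.1 k i) / K := by
    intro w p i
    simp only [inputDeviation, commonOutput, Finset.sum_add_distrib, Finset.sum_const,
      Finset.card_univ, Fintype.card_fin, nsmul_eq_mul]
    field_simp
    ring
  have hL : ∀ i, MemLp (fun p : (Fin K → Fin n → ℝ) × (Fin n → ℝ) => ∑ k, p.1 k i) 2
      ((gaussianSeqs K n Q).prod (gaussianSeq n 1)) := fun i =>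
    memLp_finsetSum _ fun k _ => (memLp_eval_gaussianSeqs Q k i).comp_fst _
  refine c.log_card_le_of_deviation hM hP hQ ht (by positivity) hpow
    (m := fun y i => (∑ k, y k i) / K) (by fun_prop) (fun w i => ?_) ?_
  · simp_rw [hdev, div_eq_mul_inv]
    exact (hL i).neg.mul_const _
  · simp_rw [hdev, div_pow, neg_sq, ← Finset.sum_div]
    rw [integral_div, integral_fun_fst (fun s : Fin K → Fin n → ℝ => ∑ i, (∑ k, s k i) ^ 2),
      integral_sum_sum_sq_gaussianSeqs hQ.le]
    simp only [probReal_univ, one_smul, Finset.sum_const, Finset.card_univ, Fintype.card_fin,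
      nsmul_eq_mul]
    apply le_of_eq
    field_simp

end Code

/-! ### From finite blocklength to achievable rates. -/

theorem numMessages_pos (n : ℕ) (R : ℝ) : 0 < numMessages n R :=
  Nat.ceil_pos.2 (by positivity)

theorem le_log_numMessages (n : ℕ) (R : ℝ) : n * R * Real.log 2 ≤ Real.log (numMessages n R) := by
  rw [← Real.log_rpow two_pos]
  exact Real.log_le_log (by positivity) (Nat.le_ceil _)

/-- If the number of messages of all codes obeys a bound of Fano type, so does an achievable
rate. -/
theorem IsAchievable.mul_le {K : ℕ} {P Q R B : ℝ} (h : IsAchievable K P Q R)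
    (hB : ∀ n M : ℕ, 0 < M → ∀ c : Code K n M, c.PowerConstraint P Q →
      K * (1 - c.errorProb Q) * Real.log M ≤ K + n * B) :
    K * R * Real.log 2 ≤ B := by
  obtain ⟨hR, c, hpow, hlim⟩ := h
  have hl : Tendsto (fun n : ℕ => K * (1 - (c n).errorProb Q) * (R * Real.log 2)) atTop
      (𝓝 (K * (1 - 0) * (R * Real.log 2))) :=
    ((tendsto_const_nhds.sub hlim).const_mul _).mul_const _
  have hr : Tendsto (fun n : ℕ => (K : ℝ) / n + B) atTop (𝓝 (0 + B)) :=
    (tendsto_const_div_atTop_nhds_zero_nat (K : ℝ)).add_const B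
  have hle := le_of_tendsto_of_tendsto hl hr ?_
  · simpa [mul_assoc] using hle
  -- An error probability below one makes the factor of `log M` nonnegative, so `M` may be replaced
  -- by its lower bound `2 ^ (n * R)`.
  filter_upwards [hlim.eventually (gt_mem_nhds one_pos), eventually_gt_atTop 0] with n hn hn0
  have hn' : (0 : ℝ) < n := by exact_mod_cast hn0
  have h1 := hB n _ (numMessages_pos n R) (c n) (hpow n)
  have h2 : K * (1 - (c n).errorProb Q) * (n * R * Real.log 2) ≤
      K * (1 - (c n).errorProb Q) * Real.log (numMessages n R) :=
    mul_le_mul_of_nonneg_left (le_log_numMessages n R)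
      (mul_nonneg (by positivity) (by linarith))
  have h3 : (K : ℝ) / n + B = (K + n * B) / n := by field_simp
  rw [h3, le_div_iff₀ hn']
  linarith

/-- Optimizing the weight `t`: the minimum of `t * P + Q / t` is `2 * √(P * Q)`, at `t = √Q / √P`.
-/
theorem IsAchievable.mul_le_of_deviation {K : ℕ} (hK : 0 < K) {P Q R v : ℝ} (hP : 0 ≤ P)
    (hQ : 0 < Q) (h : IsAchievable K P Q R) (hv : v = P + 1 ∨ v = Q / K) :
    K * R * Real.log 2 ≤
      K / 2 * (Real.log (P + Q + 1 + 2 * Real.sqrt (P * Q)) - Real.log Q) +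
        1 / 2 * Real.log v := by
  have ht : ∀ t : ℝ, 0 < t → K * R * Real.log 2 ≤
      K / 2 * (Real.log ((1 + t) * P + (1 + 1 / t) * Q + 1) - Real.log Q) +
        1 / 2 * Real.log v := by
    intro t ht
    rcases hv with rfl | rfl
    · exact h.mul_le fun n M hM c hc => c.log_card_le_of_power hM hP hQ ht hc
    · exact h.mul_le fun n M hM c hc => c.log_card_le_of_interference hK hM hP hQ ht hc
  rcases hP.eq_or_lt with rfl | hP
  -- With `P = 0` the infimum is not attained, and `t → ∞` takes its place.
  · have hlim : Tendsto (fun t : ℝ =>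
        K / 2 * (Real.log ((1 + t) * 0 + (1 + 1 / t) * Q + 1) - Real.log Q) + 1 / 2 * Real.log v)
        atTop (𝓝 (K / 2 * (Real.log ((1 + 0) * Q + 1) - Real.log Q) + 1 / 2 * Real.log v)) := by
      have h0 : Tendsto (fun t : ℝ => 1 / t) atTop (𝓝 0) := by
        simpa using tendsto_inv_atTop_zero (𝕜 := ℝ)
      have h1 : Tendsto (fun t : ℝ => (1 + t) * 0 + (1 + 1 / t) * Q + 1) atTop
          (𝓝 ((1 + 0) * Q + 1)) := by
        simpa using ((h0.const_add 1).mul_const Q).add_const 1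
      exact (((h1.log (by positivity)).sub_const _).const_mul _).add_const _
    have := ge_of_tendsto hlim ((eventually_gt_atTop 0).mono ht)
    simpa using this
  · have h1 := ht (Real.sqrt Q / Real.sqrt P) (by positivity)
    have h2 : (1 + Real.sqrt Q / Real.sqrt P) * P + (1 + 1 / (Real.sqrt Q / Real.sqrt P)) * Q + 1 =
        P + Q + 1 + 2 * Real.sqrt (P * Q) := by
      rw [Real.sqrt_mul hP.le]
      have hp : 0 < Real.sqrt P := Real.sqrt_pos.2 hP
      have hq : 0 < Real.sqrt Q := Real.sqrt_pos.2 hQ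
      have e1 := Real.sq_sqrt hP.le
      have e2 := Real.sq_sqrt hQ.le
      generalize Real.sqrt P = a at *
      generalize Real.sqrt Q = b at *
      subst e1 e2
      field_simp
      ring
    rwa [h2] at h1

/-- The upper bound on the achievable common rates. -/
theorem IsAchievable.le_bound {K : ℕ} (hK : 1 ≤ K) {P Q R : ℝ} (hP : 0 ≤ P) (hQ : 0 < Q)
    (h : IsAchievable K P Q R) :
    R ≤ 1 / 2 * Real.logb 2 (P + Q + 1 + 2 * Real.sqrt (P * Q))
        - ((K : ℝ) - 1) / (2 * K) * Real.logb 2 Q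
        - 1 / (2 * K) * Real.logb 2 K
        - max (1 / (2 * K) * Real.logb 2 (Q / (K * (P + 1)))) 0 := by
  have hK0 : (0 : ℝ) < K := by exact_mod_cast hK
  have hl : 0 < Real.log 2 := Real.log_pos one_lt_two
  have h1 := h.mul_le_of_deviation hK hP hQ (Or.inl rfl)
  have h2 := h.mul_le_of_deviation hK hP hQ (Or.inr rfl)
  rw [Real.log_div hQ.ne' hK0.ne'] at h2
  rw [le_sub_comm]
  simp only [Real.logb]
  rw [Real.log_div hQ.ne' (by positivity), Real.log_mul hK0.ne' (by positivity)]
  generalize Real.log (P + Q + 1 + 2 * Real.sqrt (P * Q)) = A at *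
  generalize Real.log (P + 1) = B at *
  generalize Real.log (K : ℝ) = C at *
  generalize Real.log Q = D at *
  generalize Real.log 2 = L at *
  -- The positive branch is the bound with `v = P + 1`; the zero branch is the one with `v = Q / K`.
  apply max_le
  · have : 1 / 2 * (A / L) - (K - 1) / (2 * K) * (D / L) - 1 / (2 * K) * (C / L) - R
        - 1 / (2 * K) * ((D - (C + B)) / L) =
        (K / 2 * (A - D) + 1 / 2 * B - K * R * L) / (K * L) := by
      field_simp
      ring
    have h3 : 0 ≤ (K / 2 * (A - D) + 1 / 2 * B - K * R * L) / (K * L) :=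
      div_nonneg (by linarith) (by positivity)
    linarith
  · have : 1 / 2 * (A / L) - (K - 1) / (2 * K) * (D / L) - 1 / (2 * K) * (C / L) - R =
        (K / 2 * (A - D) + 1 / 2 * (D - C) - K * R * L) / (K * L) := by
      field_simp
      ring
    rw [this]
    exact div_nonneg (by linarith) (by positivity)

/-! ### Random codebooks -/

/-- A random codebook with `L` codewords for each of `M` messages: for most `ω`, message `w` has a
codeword in the set `G ω`, and no codeword of another message lies in a set `T u ω` with `u` a
codeword of `w` in `G ω`. -/
theorem exists_codebook {E Ω : Type*} [MeasurableSpace E] [MeasurableSpace Ω] (ρ : Measure E)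
    [IsProbabilityMeasure ρ] (μ : Measure Ω) [IsProbabilityMeasure μ] {G : Set (E × Ω)}
    (hG : MeasurableSet G) {T : Set (E × E × Ω)} (hT : MeasurableSet T) {S : Set Ω}
    (hS : MeasurableSet S) {p q : ℝ≥0∞} (hp : ∀ ω, ρ {u | (u, ω) ∈ G} ≤ p)
    (hp' : ∀ ω ∈ S, p ≤ ρ {u | (u, ω) ∈ G}) (hq : ∀ u ω, ρ {u' | (u', u, ω) ∈ T} ≤ q) (M L : ℕ) :
    ∃ C : Fin M × Fin L → E, ∑ w, μ {ω | (∀ l, (C (w, l), ω) ∉ G) ∨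
        ∃ l, ∃ j : Fin M × Fin L, j.1 ≠ w ∧ (C (w, l), ω) ∈ G ∧ (C j, C (w, l), ω) ∈ T} ≤
      M * (μ Sᶜ + (1 - p) ^ L + L * (M * L * (p * q))) := by
  classical
  let ν : Measure (Fin M × Fin L → E) := Measure.pi fun _ => ρ
  have hswap : ∀ A : Set ((Fin M × Fin L → E) × Ω), MeasurableSet A →
      ∫⁻ C, μ {ω | (C, ω) ∈ A} ∂ν = ∫⁻ ω, ν {C | (C, ω) ∈ A} ∂μ := fun A hA => by
    have h1 := Measure.prod_apply (μ := ν) (ν := μ) hA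
    have h2 := Measure.prod_apply_symm (μ := ν) (ν := μ) hA
    exact h1.symm.trans h2
  let A₁ : Fin M → Set ((Fin M × Fin L → E) × Ω) := fun w => {x | ∀ l, (x.1 (w, l), x.2) ∉ G}
  let A₂ : Fin M → Fin L → Fin M × Fin L → Set ((Fin M × Fin L → E) × Ω) := fun w l j =>
    {x | j.1 ≠ w ∧ (x.1 (w, l), x.2) ∈ G ∧ (x.1 j, x.1 (w, l), x.2) ∈ T}
  have hA₁ : ∀ w, MeasurableSet (A₁ w) := fun w => by
    have : A₁ w = ⋂ l, (fun x : (Fin M × Fin L → E) × Ω => (x.1 (w, l), x.2)) ⁻¹' Gᶜ := by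
      ext x; simp [A₁]
    rw [this]
    exact MeasurableSet.iInter fun l => hG.compl.preimage (by fun_prop)
  have hA₂ : ∀ w l j, MeasurableSet (A₂ w l j) := fun w l j =>
    (MeasurableSet.const _).inter ((hG.preimage (f := fun x : (Fin M × Fin L → E) × Ω =>
      (x.1 (w, l), x.2)) (by fun_prop)).inter (hT.preimage
        (f := fun x : (Fin M × Fin L → E) × Ω => (x.1 j, x.1 (w, l), x.2)) (by fun_prop)))
  have h₁ : ∀ w, ∫⁻ C, μ {ω | (C, ω) ∈ A₁ w} ∂ν ≤ μ Sᶜ + (1 - p) ^ L := by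
    intro w
    rw [hswap _ (hA₁ w)]
    have hω : ∀ ω, ν {C | (C, ω) ∈ A₁ w} ≤ Sᶜ.indicator 1 ω + (1 - p) ^ L := by
      intro ω
      by_cases hω : ω ∈ S
      · have hGω : MeasurableSet {u | (u, ω) ∈ G} := hG.preimage (by fun_prop)
        -- All `L` codewords of `w` miss the set `G ω`: a product event, constrained only in the
        -- coordinates of message `w`.
        have hset : {C | (C, ω) ∈ A₁ w} =
            Set.univ.pi fun i : Fin M × Fin L =>
              if i.1 = w then {u | (u, ω) ∈ G}ᶜ else Set.univ := by
          ext C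
          simp only [A₁, Set.mem_ofPred_eq, Set.mem_univ_pi]
          constructor
          · rintro h ⟨w', l⟩
            by_cases hw : w' = w
            · subst hw; simpa using h l
            · simp [hw]
          · intro h l
            simpa using h (w, l)
        rw [hset, Measure.pi_pi]
        have : ∀ i : Fin M × Fin L, ρ (if i.1 = w then {u | (u, ω) ∈ G}ᶜ else Set.univ) =
            if i.1 = w then 1 - ρ {u | (u, ω) ∈ G} else 1 := by
          intro i
          split_ifs
          · exact prob_compl_eq_one_sub hGω
          · exact measure_univ
        simp_rw [this]
        rw [Fintype.prod_prod_type, Finset.prod_eq_single w (fun b _ hb => by simp [hb])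
          (fun h => absurd (Finset.mem_univ w) h)]
        simp only [if_true, Finset.prod_const, Finset.card_univ, Fintype.card_fin]
        refine le_add_left ?_
        gcongr
        exact hp' ω hω
      · refine le_add_right ?_
        simp [hω, prob_le_one]
    calc ∫⁻ ω, ν {C | (C, ω) ∈ A₁ w} ∂μ ≤ ∫⁻ ω, (Sᶜ.indicator 1 ω + (1 - p) ^ L) ∂μ :=
          lintegral_mono hω
      _ = _ := by
          rw [lintegral_add_right _ measurable_const, lintegral_indicator_one hS.compl]
          simp
  have h₂ : ∀ w l j, ∫⁻ C, μ {ω | (C, ω) ∈ A₂ w l j} ∂ν ≤ p * q := by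
    intro w l j
    rw [hswap _ (hA₂ w l j)]
    have hω : ∀ ω, ν {C | (C, ω) ∈ A₂ w l j} ≤ p * q := by
      intro ω
      by_cases hj : j.1 = w
      · simp [A₂, hj]
      -- Codewords of different messages are independent. Given the sent codeword, the rival falls
      -- in its `T`-set with probability at most `q`, and the sent one lies in `G ω` with
      -- probability at most `p`.
      have hne : j ≠ (w, l) := fun h => hj (by rw [h])
      have hind : IndepFun (fun C : Fin M × Fin L → E => C (w, l)) (fun C => C j) ν :=
        (iIndepFun_pi (μ := fun _ : Fin M × Fin L => ρ) (X := fun _ => id)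
          fun _ => aemeasurable_id).indepFun hne.symm
      have hmap := (indepFun_iff_map_prod_eq_prod_map_map
        (measurable_pi_apply _).aemeasurable (measurable_pi_apply _).aemeasurable).1 hind
      rw [(measurePreserving_eval (fun _ : Fin M × Fin L => ρ) (w, l)).map_eq,
        (measurePreserving_eval (fun _ : Fin M × Fin L => ρ) j).map_eq] at hmap
      let F : Set (E × E) := {x | (x.1, ω) ∈ G ∧ (x.2, x.1, ω) ∈ T}
      have hF : MeasurableSet F :=
        (hG.preimage (f := fun x : E × E => (x.1, ω)) (by fun_prop)).inter
          (hT.preimage (f := fun x : E × E => (x.2, x.1, ω)) (by fun_prop))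
      calc ν {C | (C, ω) ∈ A₂ w l j} ≤ ν ((fun C => (C (w, l), C j)) ⁻¹' F) :=
            measure_mono fun C hC => hC.2
        _ = (ρ.prod ρ) F := by
            rw [← hmap, Measure.map_apply (by fun_prop) hF]
        _ = ∫⁻ u, ρ {u' | (u, ω) ∈ G ∧ (u', u, ω) ∈ T} ∂ρ := Measure.prod_apply hF
        _ ≤ ∫⁻ u, {u | (u, ω) ∈ G}.indicator (fun _ => q) u ∂ρ := by
            refine lintegral_mono fun u => ?_
            by_cases hu : (u, ω) ∈ G
            · simpa [hu] using hq u ω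
            · simp [hu]
        _ = q * ρ {u | (u, ω) ∈ G} := lintegral_indicator_const (hG.preimage (by fun_prop)) q
        _ ≤ p * q := by rw [mul_comm]; gcongr; exact hp ω
    calc ∫⁻ ω, ν {C | (C, ω) ∈ A₂ w l j} ∂μ ≤ ∫⁻ _, p * q ∂μ := lintegral_mono hω
      _ = p * q := by simp
  let g : (Fin M × Fin L → E) → ℝ≥0∞ := fun C =>
    ∑ w, (μ {ω | (C, ω) ∈ A₁ w} + ∑ l, ∑ j, μ {ω | (C, ω) ∈ A₂ w l j})
  have hm₁ : ∀ w, Measurable fun C => μ {ω | (C, ω) ∈ A₁ w} := fun w =>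
    measurable_measure_prodMk_left (hA₁ w)
  have hm₂ : ∀ w l j, Measurable fun C => μ {ω | (C, ω) ∈ A₂ w l j} := fun w l j =>
    measurable_measure_prodMk_left (hA₂ w l j)
  have hm₃ : ∀ w l, Measurable fun C => ∑ j, μ {ω | (C, ω) ∈ A₂ w l j} := fun w l =>
    Finset.measurable_sum _ fun j _ => hm₂ w l j
  have hm₄ : ∀ w, Measurable fun C =>
      μ {ω | (C, ω) ∈ A₁ w} + ∑ l, ∑ j, μ {ω | (C, ω) ∈ A₂ w l j} := fun w =>
    (hm₁ w).add (Finset.measurable_sum _ fun l _ => hm₃ w l)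
  have hgm : Measurable g := Finset.measurable_sum _ fun w _ => hm₄ w
  -- The error is summed over messages before choosing, so that one codebook serves all of them.
  obtain ⟨C, hC⟩ := exists_le_lintegral (μ := ν) hgm.aemeasurable
  refine ⟨C, ?_⟩
  calc _ ≤ g C := by
        refine Finset.sum_le_sum fun w _ => ?_
        refine (measure_mono (t := {ω | (C, ω) ∈ A₁ w} ∪ ⋃ l, ⋃ j, {ω | (C, ω) ∈ A₂ w l j})
          fun ω hω => ?_).trans ((measure_union_le _ _).trans ?_)
        · rcases hω with h | ⟨l, j, h⟩
          · exact Or.inl h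
          · exact Or.inr (Set.mem_iUnion.2 ⟨l, Set.mem_iUnion.2 ⟨j, h⟩⟩)
        · gcongr
          refine (measure_iUnion_fintype_le _ _).trans (Finset.sum_le_sum fun l _ => ?_)
          exact measure_iUnion_fintype_le _ _
    _ ≤ ∫⁻ C, g C ∂ν := hC
    _ = ∑ w, (∫⁻ C, μ {ω | (C, ω) ∈ A₁ w} ∂ν
          + ∑ l, ∑ j, ∫⁻ C, μ {ω | (C, ω) ∈ A₂ w l j} ∂ν) := by
        rw [lintegral_finsetSum _ fun w _ => hm₄ w]
        refine Finset.sum_congr rfl fun w _ => ?_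
        rw [lintegral_add_left (hm₁ w), lintegral_finsetSum _ fun l _ => hm₃ w l]
        congr 1
        refine Finset.sum_congr rfl fun l _ => ?_
        rw [lintegral_finsetSum _ fun j _ => hm₂ w l j]
    _ ≤ ∑ w : Fin M, (μ Sᶜ + (1 - p) ^ L + ∑ l : Fin L, ∑ j : Fin M × Fin L, p * q) :=
        Finset.sum_le_sum fun w _ => add_le_add (h₁ w)
          (Finset.sum_le_sum fun l _ => Finset.sum_le_sum fun j _ => h₂ w l j)
    _ = _ := by simp [mul_add]

/-- A measurable choice from finitely many measurable sets. -/
theorem exists_measurable_choice {Ω : Type*} [MeasurableSpace Ω] {M : ℕ} (hM : 0 < M)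
    {A : Fin M → Set Ω} (hA : ∀ i, MeasurableSet (A i)) :
    ∃ f : Ω → Fin M, Measurable f ∧ ∀ ω, (∃ i, ω ∈ A i) → ω ∈ A (f ω) := by
  classical
  -- The condition is vacuous at `N = M`, so a least index always exists. Reducing modulo `M` makes
  -- it a legal index, with a harmless value where no set contains `ω`.
  have hex : ∀ ω, ∃ N : ℕ, ∀ hi : N < M, (∃ i, ω ∈ A i) → ω ∈ A ⟨N, hi⟩ := fun ω =>
    ⟨M, fun h => absurd h (lt_irrefl M)⟩
  have hlt : ∀ ω, Nat.find (hex ω) % M < M := fun ω => Nat.mod_lt _ hM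
  refine ⟨fun ω => ⟨Nat.find (hex ω) % M, hlt ω⟩, ?_, ?_⟩
  · have h1 : Measurable fun ω => Nat.find (hex ω) := by
      refine measurable_find hex fun N => ?_
      by_cases hN : N < M
      · have : {x | ∀ hi : N < M, (∃ i, x ∈ A i) → x ∈ A ⟨N, hi⟩} =
            (⋃ i, A i)ᶜ ∪ A ⟨N, hN⟩ := by
          ext x
          simp [hN, imp_iff_not_or]
        rw [this]
        exact (MeasurableSet.iUnion hA).compl.union (hA _)
      · simp [hN]
    exact (measurable_of_countable fun N : ℕ => (⟨N % M, Nat.mod_lt _ hM⟩ : Fin M)).comp h1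
  · intro ω hω
    have hω' := hω
    obtain ⟨i, hi⟩ := hω'
    have h2 : Nat.find (hex ω) ≤ i := Nat.find_min' (hex ω) fun _ _ => hi
    have h3 := h2.trans_lt i.2
    have h4 := Nat.find_spec (hex ω) h3 hω
    change ω ∈ A ⟨Nat.find (hex ω) % M, hlt ω⟩
    rwa [show (⟨Nat.find (hex ω) % M, hlt ω⟩ : Fin M) = ⟨Nat.find (hex ω), h3⟩ from
      Fin.ext (Nat.mod_eq_of_lt h3)]

/-! ### Dirty-paper coding -/

/-- The sequences whose squared Euclidean distance from `a` is at most `r`. -/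
def energyBall {n : ℕ} (a : Fin n → ℝ) (r : ℝ) : Set (Fin n → ℝ) :=
  {x | ∑ i, (x i - a i) ^ 2 ≤ r}

theorem mem_energyBall {n : ℕ} {a x : Fin n → ℝ} {r : ℝ} :
    x ∈ energyBall a r ↔ ∑ i, (x i - a i) ^ 2 ≤ r := Iff.rfl

theorem measurableSet_energyBall_preimage {Ω : Type*} [MeasurableSpace Ω] {n : ℕ}
    {f g : Ω → Fin n → ℝ} (hf : Measurable f) (hg : Measurable g) (r : ℝ) :
    MeasurableSet {ω | f ω ∈ energyBall (g ω) r} := by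
  simp only [mem_energyBall]
  exact measurableSet_le (by fun_prop) measurable_const

theorem volume_energyBall {n : ℕ} (a : Fin n → ℝ) (r : ℝ) :
    volume (energyBall a r) = volume (energyBall (0 : Fin n → ℝ) r) := by
  rw [← measure_preimage_add_right volume (-a) (energyBall 0 r)]
  congr 1
  ext x
  simp [mem_energyBall, sub_eq_add_neg]

-- Only ratios of ball volumes enter the coding argument, so translation invariance and this scaling
-- law suffice and no volume formula is needed.
open scoped Pointwise in
theorem volume_energyBall_sq_mul {n : ℕ} {c : ℝ} (hc : 0 < c) (r : ℝ) :
    volume (energyBall (0 : Fin n → ℝ) (c ^ 2 * r)) =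
      ENNReal.ofReal (c ^ n) * volume (energyBall (0 : Fin n → ℝ) r) := by
  have h : energyBall (0 : Fin n → ℝ) (c ^ 2 * r) = c • energyBall (0 : Fin n → ℝ) r := by
    ext x
    rw [Set.mem_smul_set_iff_inv_smul_mem₀ hc.ne']
    simp only [mem_energyBall, Pi.smul_apply, smul_eq_mul, Pi.zero_apply, sub_zero, mul_pow,
      ← Finset.mul_sum]
    rw [inv_pow, inv_mul_le_iff₀ (by positivity)]
  rw [h, Measure.addHaar_smul_of_nonneg _ hc.le]
  simp

theorem closedBall_subset_energyBall {n : ℕ} {P : ℝ} (hP : 0 ≤ P) :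
    Metric.closedBall (0 : Fin n → ℝ) (Real.sqrt P) ⊆ energyBall 0 (n * P) := by
  intro x hx
  rw [mem_closedBall_zero_iff] at hx
  rw [mem_energyBall]
  calc ∑ i, (x i - (0 : Fin n → ℝ) i) ^ 2 ≤ ∑ _i : Fin n, P := by
        refine Finset.sum_le_sum fun i _ => ?_
        rw [Pi.zero_apply, sub_zero, ← Real.sq_sqrt hP, ← sq_abs (x i)]
        exact pow_le_pow_left₀ (abs_nonneg _) ((norm_le_pi_norm x i).trans hx) 2
    _ = n * P := by simp

theorem energyBall_subset_closedBall {n : ℕ} (a : Fin n → ℝ) (r : ℝ) :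
    energyBall a r ⊆ Metric.closedBall a (Real.sqrt r) := by
  intro x hx
  rw [mem_energyBall] at hx
  rw [Metric.mem_closedBall, dist_pi_le_iff (Real.sqrt_nonneg _)]
  intro i
  rw [Real.dist_eq]
  refine Real.abs_le_sqrt (le_trans ?_ hx)
  exact Finset.single_le_sum (f := fun i => (x i - a i) ^ 2) (fun i _ => sq_nonneg _)
    (Finset.mem_univ i)

theorem memLp_sq_gaussianReal : MemLp (fun x : ℝ => x ^ 2) 2 (gaussianReal 0 1) := by
  rw [memLp_two_iff_integrable_sq (Measurable.aestronglyMeasurable (by fun_prop))]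
  have h := (memLp_id_gaussianReal (μ := 0) (v := 1) 4).integrable_norm_pow (p := 4) (by norm_num)
  refine h.congr (ae_of_all _ fun x => ?_)
  simp only [id, Real.norm_eq_abs]
  rw [← pow_mul, ← abs_pow, abs_of_nonneg (by positivity)]

/-- A bound on the probability that Gaussian noise, scaled by `α ≤ 1`, takes a fixed sequence of
power `B` outside the expected ball. -/
theorem gaussianSeq_noise_le {n : ℕ} (hn : 0 < n) {B α δ : ℝ} (hα : 0 ≤ α) (hα1 : α ≤ 1)
    (hδ : 0 < δ) (b : Fin n → ℝ) (hb : ∑ i, b i ^ 2 ≤ n * B) :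
    gaussianSeq n 1 {z | n * (B + α ^ 2 + 3 * δ) < ∑ i, (b i + α * z i) ^ 2} ≤
      ENNReal.ofReal ((B + Var[fun x => x ^ 2; gaussianReal 0 1]) / (n * δ ^ 2)) := by
  have hn0 : (0 : ℝ) < n := by exact_mod_cast hn
  have hnn : (1 : ℝ).toNNReal = 1 := Real.toNNReal_one
  set v := Var[fun x => x ^ 2; gaussianReal 0 1] with hv
  have hv0 : 0 ≤ v := variance_nonneg _ _
  have hm1 : ∀ i : Fin n, MemLp (fun x : ℝ => b i * x) 2 (gaussianReal 0 1) := fun i =>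
    (memLp_id_gaussianReal (μ := 0) (v := 1) 2).const_mul (b i)
  have hL1 : MemLp (fun z : Fin n → ℝ => ∑ i, b i * z i) 2 (gaussianSeq n 1) :=
    memLp_finsetSum _ fun i _ => (memLp_eval_gaussianSeq 1 i).const_mul (b i)
  have hL2 : MemLp (fun z : Fin n → ℝ => ∑ i, z i ^ 2) 2 (gaussianSeq n 1) := by
    refine memLp_finsetSum _ fun i _ => ?_
    unfold gaussianSeq
    rw [hnn]
    exact memLp_sq_gaussianReal.comp_measurePreserving
      (measurePreserving_eval (fun _ : Fin n => gaussianReal 0 1) i)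
  have hv1 : Var[fun z : Fin n → ℝ => ∑ i, b i * z i; gaussianSeq n 1] ≤ n * B := by
    have h := variance_sum_pi (μ := fun _ : Fin n => gaussianReal 0 1)
      (X := fun i x => b i * x) hm1
    have h2 : ∀ i, Var[fun x : ℝ => b i * x; gaussianReal 0 1] = b i ^ 2 := fun i => by
      rw [variance_const_mul, variance_fun_id_gaussianReal]; simp
    simp_rw [h2] at h
    refine le_trans (le_of_eq ?_) hb
    rw [← h]
    unfold gaussianSeq
    rw [hnn]
    congr 1
    ext z
    simp
  have hv2 : Var[fun z : Fin n → ℝ => ∑ i, z i ^ 2; gaussianSeq n 1] = n * v := by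
    have h := variance_sum_pi (μ := fun _ : Fin n => gaussianReal 0 1)
      (X := fun _ x => x ^ 2) fun _ => memLp_sq_gaussianReal
    rw [Finset.sum_const, ← hv, Finset.card_univ, Fintype.card_fin, nsmul_eq_mul] at h
    rw [← h]
    unfold gaussianSeq
    rw [hnn]
    congr 1
    ext z
    simp
  have he1 : ∫ z, ∑ i, b i * z i ∂(gaussianSeq n 1) = 0 := by
    rw [integral_finsetSum _ fun i _ =>
      ((memLp_eval_gaussianSeq 1 i).const_mul (b i)).integrable (by norm_num)]
    simp_rw [integral_const_mul, integral_eval_gaussianSeq]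
    simp
  have he2 : ∫ z, ∑ i, z i ^ 2 ∂(gaussianSeq n 1) = n := by
    rw [integral_sum_sq_gaussianSeq zero_le_one, mul_one]
  have c1 := meas_ge_le_variance_div_sq hL1 (c := n * δ) (by positivity)
  have c2 := meas_ge_le_variance_div_sq hL2 (c := n * δ) (by positivity)
  rw [he1] at c1
  rw [he2, hv2] at c2
  calc _ ≤ gaussianSeq n 1 ({z | n * δ ≤ |∑ i, b i * z i - 0|} ∪
        {z | n * δ ≤ |∑ i, z i ^ 2 - n|}) := by
        refine measure_mono fun z hz => ?_
        by_contra hcon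
        simp only [Set.mem_union, Set.mem_ofPred_eq, not_or, not_le, sub_zero] at hcon
        obtain ⟨h1, h2⟩ := hcon
        have h1' := (le_abs_self _).trans h1.le
        have h2' := (le_abs_self _).trans h2.le
        have hexp : ∑ i, (b i + α * z i) ^ 2 =
            ∑ i, b i ^ 2 + 2 * α * ∑ i, b i * z i + α ^ 2 * ∑ i, z i ^ 2 := by
          simp only [Finset.mul_sum, ← Finset.sum_add_distrib]
          exact Finset.sum_congr rfl fun i _ => by ring
        have hz' : n * (B + α ^ 2 + 3 * δ) < ∑ i, (b i + α * z i) ^ 2 := hz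
        rw [hexp] at hz'
        -- Of the slack `3 * δ`, two parts pay for the cross term and one for the fluctuation of the
        -- noise energy.
        have h3 : 2 * α * ∑ i, b i * z i ≤ 2 * (n * δ) := by
          calc 2 * α * ∑ i, b i * z i ≤ 2 * α * (n * δ) := by gcongr
            _ ≤ 2 * 1 * (n * δ) := by gcongr
            _ = _ := by ring
        have h4 : α ^ 2 * ∑ i, z i ^ 2 ≤ n * α ^ 2 + n * δ := by
          have hα2 : α ^ 2 ≤ 1 := pow_le_one₀ hα hα1
          calc α ^ 2 * ∑ i, z i ^ 2 ≤ α ^ 2 * (n + n * δ) := by gcongr; linarith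
            _ = n * α ^ 2 + α ^ 2 * (n * δ) := by ring
            _ ≤ n * α ^ 2 + 1 * (n * δ) := by gcongr
            _ = _ := by ring
        linarith
    _ ≤ _ := measure_union_le _ _
    _ ≤ ENNReal.ofReal (n * B / (n * δ) ^ 2) + ENNReal.ofReal (n * v / (n * δ) ^ 2) := by
        refine add_le_add (c1.trans (ENNReal.ofReal_le_ofReal ?_)) c2
        gcongr
    _ = _ := by
        have hB : 0 ≤ n * B := le_trans (by positivity) hb
        rw [← ENNReal.ofReal_add (by positivity) (by positivity)]
        congr 1
        field_simp

/-- Truncates the unbounded interference, so that codewords can be uniform on a bounded region. -/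
theorem exists_measure_compl_closedBall_le {E : Type*} [NormedAddCommGroup E] [MeasurableSpace E]
    [OpensMeasurableSpace E] (μ : Measure E) [IsFiniteMeasure μ] {ε : ℝ≥0∞} (hε : 0 < ε) :
    ∃ r : ℝ, 0 < r ∧ μ (Metric.closedBall 0 r)ᶜ ≤ ε := by
  have h : Tendsto (fun k : ℕ => μ (Metric.closedBall (0 : E) k)ᶜ) atTop (𝓝 0) := by
    have h1 := tendsto_measure_iInter_atTop (μ := μ)
      (s := fun k : ℕ => (Metric.closedBall (0 : E) k)ᶜ)
      (fun k => Metric.isClosed_closedBall.measurableSet.compl.nullMeasurableSet)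
      (fun i j hij => Set.compl_subset_compl.2 (Metric.closedBall_subset_closedBall (by gcongr)))
      ⟨0, measure_ne_top _ _⟩
    have h2 : ⋂ k : ℕ, (Metric.closedBall (0 : E) k)ᶜ = ∅ := by
      rw [← Set.compl_iUnion, Metric.iUnion_closedBall_nat, Set.compl_univ]
    rwa [h2, measure_empty] at h1
  obtain ⟨k, hk, hk0⟩ := ((h.eventually (gt_mem_nhds hε)).and (eventually_gt_atTop 0)).exists
  exact ⟨k, by exact_mod_cast hk0, hk.le⟩

/-- A dirty-paper code: the encoder knows the interference, quantizes it to a codeword of the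
message within the power constraint, and the decoder looks for a codeword near the scaled
output. -/
theorem exists_dirtyPaperCode {n M : ℕ} (hn : 0 < n) (hM : 0 < M) {P Q δ t : ℝ} (hP : 0 < P)
    (hδ : 0 < δ) (ht : 0 < t) {ε : ℝ≥0∞} (hε : 0 < ε) :
    ∃ (enc : Fin M → (Fin n → ℝ) → Fin n → ℝ) (dec : (Fin n → ℝ) → Fin M),
      (∀ w, Measurable (enc w)) ∧ Measurable dec ∧ (∀ w s, ∑ i, enc w s i ^ 2 ≤ n * P) ∧
      ∑ w, ((gaussianSeq n Q).prod (gaussianSeq n 1)) {p | dec (enc w p.1 + p.1 + p.2) ≠ w} ≤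
        M * (ε + ENNReal.ofReal (Real.exp (-t))
          + ENNReal.ofReal ((t + 1) ^ 2 * (M * Real.sqrt ((P / (P + 1) + 3 * δ) / P) ^ n))
          + ENNReal.ofReal
            ((P + Var[fun x => x ^ 2; gaussianReal 0 1]) / (n * δ ^ 2))) := by
  classical
  set α := P / (P + 1) with hαd
  have hα0 : 0 ≤ α := by positivity
  have hα1 : α ≤ 1 := (div_le_one (by positivity)).2 (by linarith)
  -- `α` is the linear MMSE coefficient: it minimizes the residual power `(1 - α) ^ 2 * P + α ^ 2`,
  -- whose minimum is `α` itself.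
  have hBα : (1 - α) ^ 2 * P + α ^ 2 = α := by rw [hαd]; field_simp; ring
  set N := α + 3 * δ with hN
  have hN0 : 0 < N := by positivity
  set c := Real.sqrt (N / P) with hc
  have hc0 : 0 < c := Real.sqrt_pos.2 (by positivity)
  have hnP : n * N = c ^ 2 * (n * P) := by
    rw [hc, Real.sq_sqrt (by positivity)]; field_simp
  set μ := (gaussianSeq n Q).prod (gaussianSeq n 1) with hμ
  obtain ⟨r, hr0, hr⟩ := exists_measure_compl_closedBall_le (gaussianSeq n Q) hε
  -- For `‖s‖ ≤ r` this ball contains the whole energy ball about `α • s`. A uniform codeword then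
  -- hits that ball with probability exactly `p`.
  let D : Set (Fin n → ℝ) := Metric.closedBall 0 (r + Real.sqrt (n * P))
  have hD : MeasurableSet D := Metric.isClosed_closedBall.measurableSet
  have hD0 : volume D ≠ 0 := (Metric.measure_closedBall_pos _ _ (by positivity)).ne'
  have hDt : volume D ≠ ∞ := measure_closedBall_lt_top.ne
  have : IsProbabilityMeasure (volume[|D] : Measure (Fin n → ℝ)) :=
    cond_isProbabilityMeasure_of_finite hD0 hDt
  set ρ : Measure (Fin n → ℝ) := volume[|D] with hρ
  have hρA : ∀ A, ρ A ≤ (volume D)⁻¹ * volume A := fun A => by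
    rw [hρ, cond_apply hD]
    gcongr
    exact Set.inter_subset_right
  have hρA' : ∀ A ⊆ D, ρ A = (volume D)⁻¹ * volume A := fun A hA => by
    rw [hρ, cond_apply hD, Set.inter_eq_right.2 hA]
  set p : ℝ≥0∞ := (volume D)⁻¹ * volume (energyBall (0 : Fin n → ℝ) (n * P)) with hp
  have hEBD : energyBall (0 : Fin n → ℝ) (n * P) ⊆ D :=
    (energyBall_subset_closedBall _ _).trans (Metric.closedBall_subset_closedBall (by linarith))
  have hp1 : p ≤ 1 := by
    rw [hp, ← hρA' _ hEBD]; exact prob_le_one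
  have hpt : p ≠ ∞ := ne_top_of_le_ne_top ENNReal.one_ne_top hp1
  have hp0 : p ≠ 0 := by
    rw [hp]
    refine mul_ne_zero (ENNReal.inv_ne_zero.2 hDt) (ne_of_gt ?_)
    exact (Metric.measure_closedBall_pos _ _ (Real.sqrt_pos.2 hP)).trans_le
      (measure_mono (closedBall_subset_energyBall hP.le))
  set x := p.toReal with hx
  have hx0 : 0 < x := ENNReal.toReal_pos hp0 hpt
  have hx1 : x ≤ 1 := ENNReal.toReal_le_of_le_ofReal zero_le_one (by simpa using hp1)
  have hpx : p = ENNReal.ofReal x := (ENNReal.ofReal_toReal hpt).symm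
  -- Then `L * x` lies between `t` and `t + 1`: enough codewords to miss with probability at most
  -- `exp (-t)`, yet so few that collisions cost only a factor `(t + 1) ^ 2`. The size of `D`, and
  -- with it `Q`, drops out.
  set L := ⌈t / x⌉₊ with hL
  have hL0 : 0 < L := Nat.ceil_pos.2 (by positivity)
  have hLx : t ≤ L * x := (div_le_iff₀ hx0).1 (Nat.le_ceil _)
  have hLx' : L * x ≤ t + 1 := by
    have h1 := (Nat.ceil_lt_add_one (show 0 ≤ t / x by positivity)).le
    calc L * x ≤ (t / x + 1) * x := by gcongr
      _ = t + x := by field_simp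
      _ ≤ t + 1 := by linarith
  let G : Set ((Fin n → ℝ) × ((Fin n → ℝ) × (Fin n → ℝ))) :=
    {a | a.1 ∈ energyBall (α • a.2.1) (n * P)}
  -- The input is the codeword minus `α • s`, so the sum in parentheses is the channel output that
  -- the codeword would cause.
  let T : Set ((Fin n → ℝ) × (Fin n → ℝ) × ((Fin n → ℝ) × (Fin n → ℝ))) :=
    {a | a.1 ∈ energyBall (α • (a.2.1 - α • a.2.2.1 + a.2.2.1 + a.2.2.2)) (n * N)}
  obtain ⟨C, hC⟩ := exists_codebook ρ μ (G := G)
    (measurableSet_energyBall_preimage (by fun_prop) (by fun_prop) _) (T := T)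
    (measurableSet_energyBall_preimage (by fun_prop) (by fun_prop) _)
    (S := Prod.fst ⁻¹' Metric.closedBall 0 r)
    (Metric.isClosed_closedBall.measurableSet.preimage measurable_fst)
    (p := p) (q := ENNReal.ofReal (c ^ n) * p)
    (fun ω => (hρA _).trans (by
      have := volume_energyBall (α • ω.1) (n * P)
      rw [hp, ← this]; rfl))
    (fun ω hω => by
      have hω' : ‖ω.1‖ ≤ r := by simpa using hω
      have hsub : energyBall (α • ω.1) (n * P) ⊆ D := by
        refine (energyBall_subset_closedBall _ _).trans (Metric.closedBall_subset_closedBall' ?_)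
        rw [dist_zero_right, norm_smul, Real.norm_of_nonneg hα0]
        nlinarith [norm_nonneg ω.1]
      have h1 := hρA' _ hsub
      rw [volume_energyBall] at h1
      exact h1.ge)
    (fun u ω => (hρA _).trans (by
      have := volume_energyBall (α • (u - α • ω.1 + ω.1 + ω.2)) (n * N)
      rw [hp, mul_left_comm, ← volume_energyBall_sq_mul hc0, ← hnP, ← this]; rfl)) M L
  -- the encoder
  have hidx := fun w => exists_measurable_choice hL0
    (A := fun l => {s | C (w, l) ∈ energyBall (α • s) (n * P)})
    fun l => measurableSet_energyBall_preimage measurable_const (by fun_prop) _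
  choose idx hidxm hidx using hidx
  let cw : Fin M → (Fin n → ℝ) → Fin n → ℝ := fun w s => C (w, idx w s)
  have hcw : ∀ w, Measurable (cw w) := fun w =>
    (measurable_of_countable fun l => C (w, l)).comp (hidxm w)
  -- Sending zero when no codeword fits makes the power constraint hold surely, not only on average.
  let enc : Fin M → (Fin n → ℝ) → Fin n → ℝ := fun w s =>
    if cw w s ∈ energyBall (α • s) (n * P) then cw w s - α • s else 0
  have henc : ∀ w, Measurable (enc w) := fun w =>
    Measurable.ite (measurableSet_energyBall_preimage (hcw w) (by fun_prop) _)
      ((hcw w).sub (by fun_prop)) measurable_const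
  have hpow : ∀ w s, ∑ i, enc w s i ^ 2 ≤ n * P := by
    intro w s
    by_cases h : cw w s ∈ energyBall (α • s) (n * P)
    · simpa [enc, h] using mem_energyBall.1 h
    · simp [enc, h]; positivity
  -- the decoder
  obtain ⟨dec, hdecm, hdec⟩ := exists_measurable_choice hM
    (A := fun w => ⋃ l, {y | C (w, l) ∈ energyBall (α • y) (n * N)})
    fun w => MeasurableSet.iUnion fun l =>
      measurableSet_energyBall_preimage measurable_const (by fun_prop) _
  refine ⟨enc, dec, henc, hdecm, hpow, ?_⟩
  have hnoise : ∀ w, μ {ω | n * N < ∑ i, (-(1 - α) * enc w ω.1 i + α * ω.2 i) ^ 2} ≤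
      ENNReal.ofReal ((P + Var[fun x => x ^ 2; gaussianReal 0 1]) / (n * δ ^ 2)) := by
    intro w
    have hew := henc w
    rw [hμ, Measure.prod_apply (measurableSet_lt measurable_const (by fun_prop))]
    calc _ ≤ ∫⁻ _, ENNReal.ofReal ((P + Var[fun x => x ^ 2; gaussianReal 0 1]) / (n * δ ^ 2))
          ∂(gaussianSeq n Q) := by
          refine lintegral_mono fun s => ?_
          have hb : ∑ i, (-(1 - α) * enc w s i) ^ 2 ≤ n * ((1 - α) ^ 2 * P) := by
            simp_rw [mul_pow, ← Finset.mul_sum, neg_sq]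
            calc (1 - α) ^ 2 * ∑ i, enc w s i ^ 2 ≤ (1 - α) ^ 2 * (n * P) := by
                  gcongr; exact hpow w s
              _ = _ := by ring
          have h1 := gaussianSeq_noise_le hn hα0 hα1 hδ _ hb
          rw [hBα, ← hN] at h1
          refine h1.trans (ENNReal.ofReal_le_ofReal ?_)
          have h2 : (1 - α) ^ 2 * P ≤ P :=
            mul_le_of_le_one_left hP.le (pow_le_one₀ (by linarith) (by linarith))
          gcongr
      _ = _ := by simp
  have herr : ∀ w, {ω : (Fin n → ℝ) × (Fin n → ℝ) | dec (enc w ω.1 + ω.1 + ω.2) ≠ w} ⊆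
      {ω | (∀ l, (C (w, l), ω) ∉ G) ∨
        ∃ l, ∃ j : Fin M × Fin L, j.1 ≠ w ∧ (C (w, l), ω) ∈ G ∧ (C j, C (w, l), ω) ∈ T} ∪
      {ω | n * N < ∑ i, (-(1 - α) * enc w ω.1 i + α * ω.2 i) ^ 2} := by
    intro w ω hω
    by_contra hcon
    simp only [Set.mem_union, Set.mem_ofPred_eq, not_or, not_forall, not_not, not_lt] at hcon
    obtain ⟨⟨⟨l, hl⟩, hcon⟩, hz⟩ := hcon
    have hgood : cw w ω.1 ∈ energyBall (α • ω.1) (n * P) := hidx w ω.1 ⟨l, hl⟩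
    have hencw : enc w ω.1 = cw w ω.1 - α • ω.1 := if_pos hgood
    have hmem : ∃ w', enc w ω.1 + ω.1 + ω.2 ∈
        ⋃ l, {y | C (w', l) ∈ energyBall (α • y) (n * N)} := by
      -- With input `x` and codeword `u = x + α s`, the output satisfies `α y - u = -(1 - α) x + α
      -- z`: the interference cancels.
      refine ⟨w, Set.mem_iUnion.2 ⟨idx w ω.1, mem_energyBall.2 (le_of_eq_of_le ?_ hz)⟩⟩
      refine Finset.sum_congr rfl fun i _ => ?_
      simp only [hencw, Pi.smul_apply, Pi.add_apply, Pi.sub_apply, smul_eq_mul, cw]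
      ring
    obtain ⟨l', hl'⟩ := Set.mem_iUnion.1 (hdec _ hmem)
    refine hcon ⟨idx w ω.1, (dec (enc w ω.1 + ω.1 + ω.2), l'), hω, hgood, ?_⟩
    change C (dec (enc w ω.1 + ω.1 + ω.2), l') ∈
      energyBall (α • (cw w ω.1 - α • ω.1 + ω.1 + ω.2)) (n * N)
    rw [← hencw]
    exact hl'
  have hcover : (1 - p) ^ L ≤ ENNReal.ofReal (Real.exp (-t)) := by
    rw [hpx, ← ENNReal.ofReal_one, ← ENNReal.ofReal_sub _ hx0.le,
      ← ENNReal.ofReal_pow (by linarith)]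
    refine ENNReal.ofReal_le_ofReal ?_
    calc (1 - x) ^ L ≤ Real.exp (-x) ^ L := by
          gcongr
          linarith [Real.add_one_le_exp (-x)]
      _ = Real.exp (-(L * x)) := by rw [← Real.exp_nat_mul]; ring_nf
      _ ≤ Real.exp (-t) := Real.exp_le_exp.2 (by linarith)
  have hpack : L * (M * L * (p * (ENNReal.ofReal (c ^ n) * p))) ≤
      ENNReal.ofReal ((t + 1) ^ 2 * (M * c ^ n)) := by
    rw [hpx, ← ENNReal.ofReal_natCast L, ← ENNReal.ofReal_natCast M,
      ← ENNReal.ofReal_mul (by positivity), ← ENNReal.ofReal_mul (by positivity),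
      ← ENNReal.ofReal_mul (by positivity), ← ENNReal.ofReal_mul (by positivity),
      ← ENNReal.ofReal_mul (by positivity)]
    refine ENNReal.ofReal_le_ofReal ?_
    calc L * (M * L * (x * (c ^ n * x))) = (L * x) ^ 2 * (M * c ^ n) := by ring
      _ ≤ _ := by gcongr
  have hS : μ (Prod.fst ⁻¹' Metric.closedBall (0 : Fin n → ℝ) r)ᶜ ≤ ε := by
    rw [← Set.preimage_compl, hμ, (measurePreserving_fst).measure_preimage
      Metric.isClosed_closedBall.measurableSet.compl.nullMeasurableSet]
    exact hr
  calc _ ≤ ∑ w, (μ {ω | (∀ l, (C (w, l), ω) ∉ G) ∨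
        ∃ l, ∃ j : Fin M × Fin L, j.1 ≠ w ∧ (C (w, l), ω) ∈ G ∧ (C j, C (w, l), ω) ∈ T} +
        ENNReal.ofReal ((P + Var[fun x => x ^ 2; gaussianReal 0 1]) / (n * δ ^ 2))) :=
        Finset.sum_le_sum fun w _ => (measure_mono (herr w)).trans
          ((measure_union_le _ _).trans (add_le_add_right (hnoise w) _))
    _ ≤ _ := by
        rw [Finset.sum_add_distrib]
        refine (add_le_add_left hC _).trans ?_
        rw [Finset.sum_const, Finset.card_univ, Fintype.card_fin, nsmul_eq_mul, ← mul_add]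
        gcongr

/-! ### Time sharing -/

theorem measurePreserving_comp_gaussianSeq {m n : ℕ} (v : ℝ) {e : Fin m → Fin n}
    (he : e.Injective) :
    MeasurePreserving (fun x : Fin n → ℝ => fun j => x (e j)) (gaussianSeq n v)
      (gaussianSeq m v) := by
  refine ⟨by fun_prop, ?_⟩
  have h := (iIndepFun_pi (μ := fun _ : Fin n => gaussianReal 0 v.toNNReal) (X := fun _ => id)
    fun _ => aemeasurable_id).precomp he
  have h2 := (iIndepFun_iff_map_fun_eq_pi_map
    fun j => (measurable_pi_apply (e j)).aemeasurable).1 h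
  refine h2.trans ?_
  unfold gaussianSeq
  congr 1
  ext1 j
  exact (measurePreserving_eval (fun _ : Fin n => gaussianReal 0 v.toNNReal) (e j)).map_eq

/-- The `j`-th slot of receiver `k` in round-robin time sharing. -/
def slot (K n : ℕ) (k : Fin K) (j : Fin (n / K)) : Fin n :=
  ⟨j * K + k, calc
    j * K + k < (j + 1) * K := by rw [add_mul, one_mul]; exact Nat.add_lt_add_left k.2 _
    _ ≤ n / K * K := Nat.mul_le_mul_right K j.2
    _ ≤ n := Nat.div_mul_le_self n K⟩

/-- The receiver to which slot `i` is allotted in round-robin time sharing. -/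
def slotUser {K n : ℕ} (hK : 0 < K) (i : Fin n) : Fin K := ⟨i % K, Nat.mod_lt _ hK⟩

theorem slotUser_slot {K n : ℕ} (hK : 0 < K) (k : Fin K) (j : Fin (n / K)) :
    slotUser hK (slot K n k j) = k :=
  Fin.ext (by simp [slotUser, slot, Nat.mod_eq_of_lt k.2])

theorem slot_div {K n : ℕ} (k : Fin K) (j : Fin (n / K)) : (slot K n k j : ℕ) / K = j := by
  have hK : 0 < K := k.pos
  change (j * K + k) / K = (j : ℕ)
  rw [mul_comm, Nat.mul_add_div hK, Nat.div_eq_of_lt k.2, add_zero]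

theorem slot_slotUser {K n : ℕ} (hK : 0 < K) (i : Fin n) (h : (i : ℕ) / K < n / K) :
    slot K n (slotUser hK i) ⟨i / K, h⟩ = i :=
  Fin.ext (Nat.div_add_mod' i K)

theorem slot_injective (K n : ℕ) :
    Function.Injective fun x : Fin K × Fin (n / K) => slot K n x.1 x.2 := by
  rintro ⟨k, j⟩ ⟨k', j'⟩ h
  have hk := (slotUser_slot k.pos k j).symm.trans
    ((congrArg (slotUser k.pos) h).trans (slotUser_slot k.pos k' j'))
  have hj : (j : ℕ) = j' := by
    rw [← slot_div k j, ← slot_div k' j']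
    exact congrArg (fun i : Fin n => (i : ℕ) / K) h
  exact Prod.ext hk (Fin.ext hj)

/-- The time-sharing code in which every receiver is served by the same dirty-paper code. -/
def timeSharingCode {K n M : ℕ} (hK : 0 < K)
    (enc : Fin M → (Fin (n / K) → ℝ) → Fin (n / K) → ℝ) (dec : (Fin (n / K) → ℝ) → Fin M)
    (henc : ∀ w, Measurable (enc w)) (hdec : Measurable dec) : Code K n M where
  -- The `n % K` slots after the last complete round carry zero.
  enc w s i := if h : (i : ℕ) / K < n / K then
    enc w (fun j => s (slotUser hK i) (slot K n (slotUser hK i) j)) ⟨i / K, h⟩ else 0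
  dec k y := dec fun j => y (slot K n k j)
  measurable_enc w := by
    have := henc w
    refine measurable_pi_iff.2 fun i => ?_
    by_cases h : (i : ℕ) / K < n / K
    · simp only [h, dite_true]
      fun_prop
    · simp only [h, dite_false]
      exact measurable_const
  measurable_dec k := by fun_prop

section TimeSharingCode

variable {K n M : ℕ} {hK : 0 < K} {enc : Fin M → (Fin (n / K) → ℝ) → Fin (n / K) → ℝ}
  {dec : (Fin (n / K) → ℝ) → Fin M} {henc : ∀ w, Measurable (enc w)} {hdec : Measurable dec}

theorem isTimeSharing_timeSharingCode : (timeSharingCode hK enc dec henc hdec).IsTimeSharing := by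
  refine ⟨slotUser hK, fun w s s' i h => ?_, fun k y y' h => ?_⟩
  · simp only [timeSharingCode]
    congr! 3
    exact h _ (slotUser_slot hK _ _)
  · simp only [timeSharingCode]
    congr 1
    exact funext fun j => h _ (slotUser_slot hK k j)

theorem timeSharingCode_enc_slot (w : Fin M) (s : Fin K → Fin n → ℝ) (k : Fin K)
    (j : Fin (n / K)) :
    (timeSharingCode hK enc dec henc hdec).enc w s (slot K n k j) =
      enc w (fun j => s k (slot K n k j)) j := by
  have h : (slot K n k j : ℕ) / K < n / K := by rw [slot_div]; exact j.2
  simp only [timeSharingCode, h, dite_true, slotUser_slot]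
  congr 1
  exact Fin.ext (slot_div k j)

theorem powerConstraint_timeSharingCode (hM : 0 < M) {P Q : ℝ} (hP : 0 ≤ P)
    (hpow : ∀ w s, ∑ j, enc w s j ^ 2 ≤ (n / K : ℕ) * P) :
    (timeSharingCode hK enc dec henc hdec).PowerConstraint P Q := by
  have hK0 : (0 : ℝ) < K := by exact_mod_cast hK
  have h : ∀ w s, ∑ i, (timeSharingCode hK enc dec henc hdec).enc w s i ^ 2 ≤ n * P := by
    intro w s
    have hsum : ∑ x : Fin K × Fin (n / K), enc w (fun j => s x.1 (slot K n x.1 j)) x.2 ^ 2 =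
        ∑ i, (timeSharingCode hK enc dec henc hdec).enc w s i ^ 2 := by
      refine Fintype.sum_of_injective (fun x : Fin K × Fin (n / K) => slot K n x.1 x.2)
        (slot_injective K n) _ _ (fun i hi => ?_)
        fun x => by rw [timeSharingCode_enc_slot]
      have : ¬ (i : ℕ) / K < n / K := fun h => hi ⟨(slotUser hK i, ⟨i / K, h⟩),
        slot_slotUser hK i h⟩
      simp only [timeSharingCode, this, dite_false]
      norm_num
    have hk : ∀ k, ∑ j, enc w (fun j => s k (slot K n k j)) j ^ 2 ≤ ((n / K : ℕ) : ℝ) * P :=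
      fun k => hpow w _
    rw [← hsum, Fintype.sum_prod_type]
    calc ∑ k, ∑ j, enc w (fun j => s k (slot K n k j)) j ^ 2
        ≤ ∑ _k : Fin K, ((n / K : ℕ) : ℝ) * P := Finset.sum_le_sum fun k _ => hk k
      _ = ((n / K * K : ℕ) : ℝ) * P := by
        rw [Finset.sum_const, Finset.card_univ, Fintype.card_fin, nsmul_eq_mul, Nat.cast_mul]
        ring
      _ ≤ n * P := by gcongr; exact Nat.div_mul_le_self n K
  unfold Code.PowerConstraint
  rw [ENNReal.inv_mul_le_iff (by simpa using hM.ne') (by simp)]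
  calc _ ≤ ∑ _w : Fin M, ENNReal.ofReal (n * P) := by
        refine Finset.sum_le_sum fun w _ => ?_
        calc _ ≤ ∫⁻ _, ENNReal.ofReal (n * P) ∂(gaussianSeqs K n Q) :=
              lintegral_mono fun s => ENNReal.ofReal_le_ofReal (h w s)
          _ = _ := by simp
    _ = _ := by simp

/-- Restricted to its own slots, each receiver sees exactly the single-receiver channel of length `n
/ K`; a union bound over the receivers gives the factor `K`. -/
theorem errorProb_timeSharingCode_le (hM : 0 < M) {Q E : ℝ} (hE : 0 ≤ E)
    (herr : ∑ w, ((gaussianSeq (n / K) Q).prod (gaussianSeq (n / K) 1))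
      {p | dec (enc w p.1 + p.1 + p.2) ≠ w} ≤ M * ENNReal.ofReal E) :
    (timeSharingCode hK enc dec henc hdec).errorProb Q ≤ K * E := by
  have hM0 : (0 : ℝ) < M := by exact_mod_cast hM
  let μ := (gaussianSeq (n / K) Q).prod (gaussianSeq (n / K) 1)
  let e : Fin M → Set ((Fin (n / K) → ℝ) × (Fin (n / K) → ℝ)) := fun w =>
    {p | dec (enc w p.1 + p.1 + p.2) ≠ w}
  have he : ∀ w, MeasurableSet (e w) := fun w => by
    have := henc w
    exact (show Measurable fun p : (Fin (n / K) → ℝ) × (Fin (n / K) → ℝ) =>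
      dec (enc w p.1 + p.1 + p.2) by fun_prop) (measurableSet_singleton w).compl
  have herr' : ∑ w, μ.real (e w) ≤ M * E := by
    have h1 := ENNReal.toReal_mono (by finiteness) herr
    rw [ENNReal.toReal_sum fun w _ => measure_ne_top _ _, ENNReal.toReal_mul,
      ENNReal.toReal_ofReal hE, ENNReal.toReal_natCast] at h1
    exact h1
  have hw : ∀ w, (timeSharingCode hK enc dec henc hdec).messageErrorProb Q w ≤
      K * μ.real (e w) := by
    intro w
    have hmp : ∀ k : Fin K, MeasurePreserving
        (Prod.map (fun s : Fin K → Fin n → ℝ => fun j => s k (slot K n k j))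
          (fun z : Fin K → Fin n → ℝ => fun j => z k (slot K n k j)))
        ((gaussianSeqs K n Q).prod (gaussianSeqs K n 1)) μ := fun k =>
      have hinj : Function.Injective (slot K n k) := fun j j' h =>
        (Prod.ext_iff.1 (slot_injective K n (a₁ := (k, j)) (a₂ := (k, j')) h)).2
      ((measurePreserving_comp_gaussianSeq Q hinj).comp
        (measurePreserving_eval_gaussianSeqs Q k)).prod
      ((measurePreserving_comp_gaussianSeq 1 hinj).comp
        (measurePreserving_eval_gaussianSeqs 1 k))
    calc _ ≤ ((gaussianSeqs K n Q).prod (gaussianSeqs K n 1)).real (⋃ k : Fin K,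
          Prod.map (fun s : Fin K → Fin n → ℝ => fun j => s k (slot K n k j))
          (fun z : Fin K → Fin n → ℝ => fun j => z k (slot K n k j)) ⁻¹' e w) := by
          refine measureReal_mono fun p hp => ?_
          obtain ⟨k, hk⟩ := hp
          refine Set.mem_iUnion.2 ⟨k, ?_⟩
          change dec _ ≠ w
          have hout : ∀ j, (timeSharingCode hK enc dec henc hdec).output w p.1 p.2 k
              (slot K n k j) = enc w (fun j => p.1 k (slot K n k j)) j
                + p.1 k (slot K n k j) + p.2 k (slot K n k j) := fun j => by
            rw [Code.output, timeSharingCode_enc_slot]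
          have hk' : dec (fun j => (timeSharingCode hK enc dec henc hdec).output w p.1 p.2 k
              (slot K n k j)) ≠ w := hk
          simp_rw [hout] at hk'
          exact hk'
      _ ≤ ∑ k : Fin K, _ := measureReal_iUnion_fintype_le _
      _ = ∑ _k : Fin K, μ.real (e w) :=
          Finset.sum_congr rfl fun k _ => (hmp k).measureReal_preimage (he w).nullMeasurableSet
      _ = K * μ.real (e w) := by simp
  rw [Code.errorProb_eq, inv_mul_le_iff₀ hM0]
  calc _ ≤ ∑ w, K * μ.real (e w) := Finset.sum_le_sum fun w _ => hw w
    _ = K * ∑ w, μ.real (e w) := by rw [Finset.mul_sum]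
    _ ≤ K * (M * E) := by gcongr
    _ = _ := by ring

end TimeSharingCode

/-- Rewrites the message count in the length `n / K` of the component code. Rounding `n` down costs
only the constant `2 ^ (K * R)`, and the ceiling costs a factor 2. -/
theorem numMessages_le {K n : ℕ} (hK : 0 < K) {R : ℝ} (hR : 0 ≤ R) :
    (numMessages n R : ℝ) ≤ 2 * (2 : ℝ) ^ (K * R) * ((2 : ℝ) ^ (K * R)) ^ (n / K) := by
  have h1 : (1 : ℝ) ≤ 2 ^ (n * R) := Real.one_le_rpow one_le_two (by positivity)
  have h2 : (n : ℝ) ≤ K + K * (n / K : ℕ) := by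
    have h := (Nat.div_add_mod n K).symm
    have h' := Nat.mod_lt n hK
    exact_mod_cast (show n ≤ K + K * (n / K) by omega)
  calc (numMessages n R : ℝ) ≤ 2 ^ (n * R) + 1 := (Nat.ceil_lt_add_one (by positivity)).le
    _ ≤ 2 * (2 : ℝ) ^ (n * R) := by linarith
    _ ≤ 2 * (2 : ℝ) ^ (K * R + K * R * (n / K : ℕ)) := by
        gcongr
        · exact one_le_two
        · nlinarith
    _ = _ := by
        rw [Real.rpow_add two_pos, Real.rpow_mul two_pos.le (K * R) ((n / K : ℕ) : ℝ),
          Real.rpow_natCast, mul_assoc]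

/-- Below `1/(2K) log (1 + P)`, time-sharing codes have arbitrarily small error probability. -/
theorem eventually_exists_timeSharing {K : ℕ} (hK : 0 < K) {P Q R : ℝ} (hP : 0 < P)
    (hR : 0 ≤ R) (hRP : R < 1 / (2 * K) * Real.logb 2 (1 + P)) {ε : ℝ} (hε : 0 < ε) :
    ∀ᶠ n in atTop, ∃ c : Code K n (numMessages n R),
      c.IsTimeSharing ∧ c.PowerConstraint P Q ∧ c.errorProb Q ≤ ε := by
  have hK0 : (0 : ℝ) < K := by exact_mod_cast hK
  set a := (2 : ℝ) ^ (K * R) with ha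
  have ha0 : 0 < a := by positivity
  have haP : a < Real.sqrt (1 + P) := by
    have h1 : K * R < Real.logb 2 (1 + P) * (1 / 2) := by
      rw [one_div_mul_eq_div, lt_div_iff₀ (by positivity)] at hRP
      linarith
    calc a < 2 ^ (Real.logb 2 (1 + P) * (1 / 2)) := Real.rpow_lt_rpow_of_exponent_lt one_lt_two h1
      _ = Real.sqrt (1 + P) := by
        rw [Real.rpow_mul two_pos.le, Real.rpow_logb two_pos (by norm_num) (by positivity),
          Real.sqrt_eq_rpow]
  obtain ⟨δ, hδ, haδ⟩ : ∃ δ : ℝ, 0 < δ ∧ a * Real.sqrt ((P / (P + 1) + 3 * δ) / P) < 1 := by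
    have hcont : Continuous fun δ : ℝ => a * Real.sqrt ((P / (P + 1) + 3 * δ) / P) := by fun_prop
    -- At `δ = 0` the volume ratio is `1 / √(1 + P)` per slot, so the rate assumption is precisely
    -- this strict inequality. By continuity it survives for small `δ`.
    have h0 : a * Real.sqrt ((P / (P + 1) + 3 * 0) / P) < 1 := by
      have : (P / (P + 1) + 3 * 0) / P = (1 + P)⁻¹ := by field_simp; ring
      rw [this, Real.sqrt_inv, ← div_eq_mul_inv]
      exact (div_lt_one (by positivity)).2 haP
    have h1 := (hcont.tendsto 0).eventually (gt_mem_nhds h0)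
    obtain ⟨δ, h2, h3⟩ := ((h1.filter_mono nhdsWithin_le_nhds).and
      (self_mem_nhdsWithin : Set.Ioi (0 : ℝ) ∈ 𝓝[>] 0)).exists
    exact ⟨δ, h3, h2⟩
  set c := Real.sqrt ((P / (P + 1) + 3 * δ) / P) with hc
  have hc0 : 0 ≤ c := Real.sqrt_nonneg _
  set V := P + Var[fun x => x ^ 2; gaussianReal 0 1] with hV
  have hV0 : 0 ≤ V := add_nonneg hP.le (variance_nonneg _ _)
  -- Four error contributions in the dirty-paper code, times `K` receivers.
  set η := ε / (4 * K) with hη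
  have hη0 : 0 < η := by positivity
  obtain ⟨t, ht, htη⟩ : ∃ t : ℝ, 0 < t ∧ Real.exp (-t) < η :=
    ((eventually_gt_atTop 0).and
      (Real.tendsto_exp_neg_atTop_nhds_zero.eventually (gt_mem_nhds hη0))).exists
  have hdiv : Tendsto (fun n : ℕ => n / K) atTop atTop := Nat.tendsto_div_const_atTop hK.ne'
  have hlim1 : Tendsto (fun m : ℕ => (t + 1) ^ 2 * (2 * a * (a * c) ^ m)) atTop (𝓝 0) := by
    simpa using ((tendsto_pow_atTop_nhds_zero_of_lt_one (by positivity) haδ).const_mul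
      (2 * a)).const_mul ((t + 1) ^ 2)
  have hlim2 : Tendsto (fun m : ℕ => V / (m * δ ^ 2)) atTop (𝓝 0) := by
    have := (tendsto_const_div_atTop_nhds_zero_nat V).div_const (δ ^ 2)
    simpa [div_div] using this
  filter_upwards [hdiv.eventually (hlim1.eventually (gt_mem_nhds hη0)),
    hdiv.eventually (hlim2.eventually (gt_mem_nhds hη0)),
    hdiv.eventually (eventually_gt_atTop 0)] with n h1 h2 h3
  obtain ⟨enc, dec, henc, hdec, hpow, herr⟩ := exists_dirtyPaperCode (n := n / K)
    (M := numMessages n R) (Q := Q) h3 (numMessages_pos n R) hP hδ ht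
    (ε := ENNReal.ofReal η) (by simpa using hη0)
  refine ⟨timeSharingCode hK enc dec henc hdec, isTimeSharing_timeSharingCode,
    powerConstraint_timeSharingCode (numMessages_pos n R) hP.le hpow, ?_⟩
  have hsum : ENNReal.ofReal η + ENNReal.ofReal (Real.exp (-t))
      + ENNReal.ofReal ((t + 1) ^ 2 * (numMessages n R * c ^ (n / K)))
      + ENNReal.ofReal (V / ((n / K : ℕ) * δ ^ 2)) ≤ ENNReal.ofReal (4 * η) := by
    rw [← ENNReal.ofReal_add hη0.le (by positivity), ← ENNReal.ofReal_add (by positivity)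
      (by positivity), ← ENNReal.ofReal_add (by positivity) (by positivity)]
    refine ENNReal.ofReal_le_ofReal ?_
    have h4 : (t + 1) ^ 2 * (numMessages n R * c ^ (n / K)) ≤
        (t + 1) ^ 2 * (2 * a * (a * c) ^ (n / K)) := by
      rw [mul_pow, ← mul_assoc (2 * a)]
      gcongr
      exact numMessages_le hK hR
    linarith
  have h5 := errorProb_timeSharingCode_le (hK := hK) (henc := henc) (hdec := hdec)
    (numMessages_pos n R) (E := 4 * η) (by positivity) (herr.trans (by gcongr))
  refine h5.trans (le_of_eq ?_)
  rw [hη]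
  field_simp

/-- The code that always sends zero and decodes the first message. -/
def zeroCode (K n : ℕ) {M : ℕ} (hM : 0 < M) : Code K n M where
  enc _ _ _ := 0
  dec _ _ := ⟨0, hM⟩
  measurable_enc _ := measurable_const
  measurable_dec _ := measurable_const

theorem isTimeSharing_zeroCode {K n M : ℕ} (hK : 0 < K) (hM : 0 < M) :
    (zeroCode K n hM).IsTimeSharing :=
  ⟨fun _ => ⟨0, hK⟩, fun _ _ _ _ _ => rfl, fun _ _ _ _ => rfl⟩

theorem powerConstraint_zeroCode {K n M : ℕ} (hM : 0 < M) (P Q : ℝ) :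
    (zeroCode K n hM).PowerConstraint P Q := by
  simp [Code.PowerConstraint, zeroCode]

/-- At rate zero there is exactly one message, so no decoder can err. This keeps the sets of
achievable rates nonempty and settles the lower bound at `P = 0`. -/
theorem isTimeSharingAchievable_zero {K : ℕ} (hK : 0 < K) (P Q : ℝ) :
    IsTimeSharingAchievable K P Q 0 := by
  refine ⟨le_rfl, fun n => zeroCode K n (numMessages_pos n 0),
    fun n => isTimeSharing_zeroCode hK _, fun n => powerConstraint_zeroCode _ P Q, ?_⟩
  have h : ∀ n, (zeroCode K n (numMessages_pos n 0)).errorProb Q = 0 := by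
    intro n
    have hsub : Subsingleton (Fin (numMessages n 0)) := by
      simp only [numMessages, mul_zero, Real.rpow_zero, Nat.ceil_one]
      infer_instance
    have hset : ∀ w, {p : (Fin K → Fin n → ℝ) × (Fin K → Fin n → ℝ) | ∃ k,
        (zeroCode K n (numMessages_pos n 0)).dec k
          ((zeroCode K n (numMessages_pos n 0)).output w p.1 p.2 k) ≠ w} = ∅ := fun w =>
      Set.eq_empty_of_forall_notMem fun p ⟨k, hk⟩ => hk (hsub.elim _ _)
    simp only [Code.errorProb, hset, measureReal_empty, Finset.sum_const_zero, mul_zero]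
  simp [h]

theorem isTimeSharingAchievable_of_lt {K : ℕ} (hK : 0 < K) {P Q R : ℝ} (hP : 0 < P)
    (hR : 0 ≤ R) (hRP : R < 1 / (2 * K) * Real.logb 2 (1 + P)) :
    IsTimeSharingAchievable K P Q R := by
  -- Small error is known only eventually, with a threshold depending on `ε`. Taking at each `n` a
  -- code within `1 / (n + 1)` of the least possible error yields one sequence that works for all
  -- `ε`.
  let S : ℕ → Set ℝ := fun n => {x | ∃ c : Code K n (numMessages n R),
    c.IsTimeSharing ∧ c.PowerConstraint P Q ∧ c.errorProb Q = x}
  have hS : ∀ n, (S n).Nonempty := fun n => ⟨_, zeroCode K n (numMessages_pos n R),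
    isTimeSharing_zeroCode hK _, powerConstraint_zeroCode _ P Q, rfl⟩
  have hbdd : ∀ n, BddBelow (S n) := fun n => ⟨0, by
    rintro _ ⟨c, -, -, rfl⟩; exact c.errorProb_nonneg Q⟩
  have hex : ∀ n : ℕ, ∃ c : Code K n (numMessages n R), c.IsTimeSharing ∧
      c.PowerConstraint P Q ∧ c.errorProb Q < sInf (S n) + 1 / ((n : ℝ) + 1) := by
    intro n
    obtain ⟨_, ⟨c, h1, h2, rfl⟩, h3⟩ := exists_lt_of_csInf_lt (hS n)
      (lt_add_of_pos_right (sInf (S n)) (show (0 : ℝ) < 1 / ((n : ℝ) + 1) by positivity))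
    exact ⟨c, h1, h2, h3⟩
  choose c hts hpow herr using hex
  refine ⟨hR, c, hts, hpow, ?_⟩
  have hinf : Tendsto (fun n => sInf (S n)) atTop (𝓝 0) := by
    refine tendsto_order.2 ⟨fun b hb => Eventually.of_forall fun n => ?_, fun b hb => ?_⟩
    · refine hb.trans_le (le_csInf (hS n) ?_)
      rintro _ ⟨c, -, -, rfl⟩
      exact c.errorProb_nonneg Q
    · filter_upwards [eventually_exists_timeSharing hK (Q := Q) hP hR hRP (half_pos hb)]
        with n ⟨c, h1, h2, h3⟩
      exact ((csInf_le (hbdd n) ⟨c, h1, h2, rfl⟩).trans h3).trans_lt (half_lt_self hb)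
  refine squeeze_zero (fun n => (c n).errorProb_nonneg Q) (fun n => (herr n).le) ?_
  simpa using hinf.add tendsto_one_div_add_atTop_nhds_zero_nat

theorem IsTimeSharingAchievable.isAchievable {K : ℕ} {P Q R : ℝ}
    (h : IsTimeSharingAchievable K P Q R) : IsAchievable K P Q R := by
  obtain ⟨hR, c, -, hpow, herr⟩ := h
  exact ⟨hR, c, hpow, herr⟩

/-! ### The limit of large interference -/

theorem le_timeSharingCapacity {K : ℕ} (hK : 1 ≤ K) {P Q : ℝ} (hP : 0 ≤ P) (hQ : 0 < Q) :
    1 / (2 * K) * Real.logb 2 (1 + P) ≤ timeSharingCapacity K P Q := by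
  have hbdd : BddAbove {R | IsTimeSharingAchievable K P Q R} :=
    ⟨_, fun R hR => IsAchievable.le_bound hK hP hQ (IsTimeSharingAchievable.isAchievable hR)⟩
  have h0 : 0 ≤ timeSharingCapacity K P Q := le_csSup hbdd (isTimeSharingAchievable_zero hK P Q)
  rcases hP.eq_or_lt with rfl | hP
  · simpa using h0
  refine le_of_forall_lt fun R hR => ?_
  obtain ⟨R', h1, h2⟩ := exists_between hR
  rcases le_or_gt 0 R' with h | h
  · exact h1.trans_le (le_csSup hbdd (isTimeSharingAchievable_of_lt hK hP h h2))
  · exact (h1.trans h).trans_le h0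

theorem timeSharingCapacity_le_capacity {K : ℕ} (hK : 1 ≤ K) {P Q : ℝ} (hP : 0 ≤ P)
    (hQ : 0 < Q) : timeSharingCapacity K P Q ≤ capacity K P Q :=
  csSup_le_csSup ⟨_, fun _ hR => IsAchievable.le_bound hK hP hQ hR⟩
    ⟨0, isTimeSharingAchievable_zero hK P Q⟩ fun _ hR => IsTimeSharingAchievable.isAchievable hR

/-- Only the `v = P + 1` half of the converse is kept. The terms in `log K` cancel, and `log Q`
survives only inside `1/2 log (σ / Q)`, whose argument tends to one. -/
theorem capacity_le {K : ℕ} (hK : 1 ≤ K) {P Q : ℝ} (hP : 0 ≤ P) (hQ : 0 < Q) :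
    capacity K P Q ≤ 1 / 2 * Real.logb 2 ((P + 1) * Q⁻¹ + 1 + 2 * (Real.sqrt P * (Real.sqrt Q)⁻¹))
      + 1 / (2 * K) * Real.logb 2 (1 + P) := by
  have hK0 : (0 : ℝ) < K := by exact_mod_cast hK
  refine csSup_le ⟨0, (isTimeSharingAchievable_zero hK P Q).isAchievable⟩ fun R hR => ?_
  have h := IsAchievable.le_bound hK hP hQ hR
  have hmax := le_max_left (1 / (2 * K) * Real.logb 2 (Q / (K * (P + 1)))) 0
  have hlog : (P + 1) * Q⁻¹ + 1 + 2 * (Real.sqrt P * (Real.sqrt Q)⁻¹) =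
      (P + Q + 1 + 2 * Real.sqrt (P * Q)) / Q := by
    rw [Real.sqrt_mul hP]
    have hq : 0 < Real.sqrt Q := Real.sqrt_pos.2 hQ
    have e2 := Real.sq_sqrt hQ.le
    generalize Real.sqrt Q = b at *
    subst e2
    field_simp
    ring
  rw [hlog, Real.logb_div (by positivity) hQ.ne']
  rw [Real.logb_div hQ.ne' (by positivity), Real.logb_mul hK0.ne' (by positivity)]
    at h hmax
  refine h.trans ?_
  rw [add_comm 1 P]
  have : (K - 1 : ℝ) / (2 * K) = 1 / 2 - 1 / (2 * K) := by field_simp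
  rw [this]
  linarith

theorem tendsto_capacity_bound (K : ℕ) (P : ℝ) :
    Tendsto (fun Q : ℝ => 1 / 2 * Real.logb 2 ((P + 1) * Q⁻¹ + 1 +
        2 * (Real.sqrt P * (Real.sqrt Q)⁻¹)) + 1 / (2 * K) * Real.logb 2 (1 + P)) atTop
      (𝓝 (1 / (2 * K) * Real.logb 2 (1 + P))) := by
  have h1 : Tendsto (fun Q : ℝ => (P + 1) * Q⁻¹ + 1 + 2 * (Real.sqrt P * (Real.sqrt Q)⁻¹)) atTop
      (𝓝 ((P + 1) * 0 + 1 + 2 * (Real.sqrt P * 0))) :=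
    ((tendsto_inv_atTop_zero.const_mul _).add_const 1).add
      (((tendsto_inv_atTop_zero.comp Real.tendsto_sqrt_atTop).const_mul _).const_mul 2)
  have h2 := (((h1.log (by norm_num)).div_const (Real.log 2)).const_mul (1 / 2)).add_const
    (1 / (2 * K) * Real.logb 2 (1 + P))
  simpa [Real.logb] using h2

end GaussianMulticast

theorem mainTheorem9 (K : ℕ) (hK : 1 ≤ K) (P : ℝ) (hP : 0 ≤ P) :
    (∀ Q : ℝ, 0 < Q → ∀ R : ℝ, GaussianMulticast.IsAchievable K P Q R →
      R ≤ 1 / 2 * Real.logb 2 (P + Q + 1 + 2 * Real.sqrt (P * Q))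
        - ((K : ℝ) - 1) / (2 * K) * Real.logb 2 Q
        - 1 / (2 * K) * Real.logb 2 K
        - max (1 / (2 * K) * Real.logb 2 (Q / (K * (P + 1)))) 0) ∧
    Tendsto (fun Q : ℝ => GaussianMulticast.capacity K P Q) atTop
      (𝓝 (1 / (2 * K) * Real.logb 2 (1 + P))) ∧
    Tendsto (fun Q : ℝ => GaussianMulticast.timeSharingCapacity K P Q) atTop
      (𝓝 (1 / (2 * K) * Real.logb 2 (1 + P))) := by
  refine ⟨fun Q hQ R hR => hR.le_bound hK hP hQ, ?_, ?_⟩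
  · refine tendsto_of_tendsto_of_tendsto_of_le_of_le' tendsto_const_nhds
      (GaussianMulticast.tendsto_capacity_bound K P) ?_ ?_
    · filter_upwards [eventually_gt_atTop 0] with Q hQ
      exact (GaussianMulticast.le_timeSharingCapacity hK hP hQ).trans
        (GaussianMulticast.timeSharingCapacity_le_capacity hK hP hQ)
    · filter_upwards [eventually_gt_atTop 0] with Q hQ
      exact GaussianMulticast.capacity_le hK hP hQ
  · refine tendsto_of_tendsto_of_tendsto_of_le_of_le' tendsto_const_nhds
      (GaussianMulticast.tendsto_capacity_bound K P) ?_ ?_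
    · filter_upwards [eventually_gt_atTop 0] with Q hQ
      exact GaussianMulticast.le_timeSharingCapacity hK hP hQ
    · filter_upwards [eventually_gt_atTop 0] with Q hQ
      exact (GaussianMulticast.timeSharingCapacity_le_capacity hK hP hQ).trans
        (GaussianMulticast.capacity_le hK hP hQ)
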